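/- Let $k\ge 1$ and let $\Lambda$ be a $k$-graph, that is, a countable small category with a degree functor $d:\Lambda\to\mathbb N^k$ having the unique factorization property: if $d(\lambda)=\mathbf n+\mathbf m$, there are unique $\alpha,\beta\in\Lambda$ with $\lambda=\alpha\beta$, $d(\alpha)=\mathbf n$, $d(\beta)=\mathbf m$. Write $r,s$ for range and source and $\Lambda^0$ for the set of vertices (objects). Assume that $\Lambda$ is row-finite without sources, i.e. $0<|\{\lambda: r(\lambda)=u,\ d(\lambda)=\mathbf n\}|<\infty$ for all $u\in\Lambda^0$ and $\mathbf n\in\mathbb N^k$, and that $\Lambda^0$ is finite. Let $1\le i\le k$ and let $v\in\Lambda^0$ be an $\mathbf e_i$-sink, i.e. there is no $\lambda\in\Lambda$ with $s(\lambda)=v$ and $d(\lambda)=\mathbf e_i$. Let $$\Lambda_S:=\{\lambda\in\Lambda \mid \text{there is no } \mu\in\Lambda \text{ with } r(\mu)=r(\lambda) \text{ and } s(\mu)=v\}$$ be the sink deletion of $\Lambda$ at $v$, a $k$-graph with the structure restricted from $\Lambda$ (again row-finite without sources). For a field $\mathsf k$ and a row-finite $k$-graph $\Omega$ without sources, let $\operatorname{KP}_{\mathsf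 k}(\Omega)$ be the Kumjian-Pask algebra: the universal associative $\mathsf k$-algebra generated by symbols $p_u$, $s_\lambda$, $s_{\lambda^*}$ ($u\in\Omega^0$, $\lambda\in\Omega$, where $s_u=s_{u^*}=p_u$ for $u \in \Omega^0$) subject to * $p_up_{u'}=\delta_{u,u'}p_u$ for $u,u'\in\Omega^0$; * $s_\lambda s_\mu=s_{\lambda\mu}$ and $s_{\mu^*}s_{\lambda^*}=s_{(\lambda\mu)^*}$ if $d(\lambda),d(\mu)\ne0$ and $s(\lambda)=r(\mu)$; and $p_{r(\lambda)}s_\lambda=s_\lambda=s_\lambda p_{s(\lambda)}$, $p_{s(\lambda)}s_{\lambda^*}=s_{\lambda^*}=s_{\lambda^*}p_{r(\lambda)}$ if $d(\lambda)\neq 0$; * $s_{\lambda^*}s_\mu=\delta_{\lambda,\mu}p_{s(\lambda)}$ if $d(\lambda)=d(\mu)\ne0$; * $p_u=\sum_{r(\lambda)=u,\,d(\lambda)=\mathbf n}s_\lambda s_{\lambda^*}$ for $u\in\Omega^0$ and $\mathbf n\in\mathbb N^k\setminus\{0\}$. It is $\mathbb Z^k$-graded with components $\operatorname{KP}_{\mathsf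 k}(\Omega)_{\mathbf n}=\operatorname{span}_{\mathsf k}\{s_\alpha s_{\beta^*}\mid s(\alpha)=s(\beta),\ d(\alpha)-d(\beta)=\mathbf n\}$, and unital if $\Omega^0$ is finite. Then, for every field $\mathsf k$, the $\mathbb Z^k$-graded algebras $\operatorname{KP}_{\mathsf k}(\Lambda)$ and $\operatorname{KP}_{\mathsf k}(\Lambda_S)$ are graded Morita equivalent: there is an equivalence between their categories of $\mathbb Z^k$-graded right modules (with degree-preserving module homomorphisms) that commutes with the shift functors $M\mapsto M(\alpha)$, $M(\alpha)_\gamma=M_{\alpha+\gamma}$, $\alpha\in\mathbb Z^k$, up to natural isomorphisms compatible with the identifications $M(0)=M$ and $M(\alpha+\beta)=M(\alpha)(\beta)$. -/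

import Mathlib

open CategoryTheory DirectSum

universe u w x

noncomputable section

/-! ## Higher-rank graphs -/

/-- A `k`-graph: a countable small category with a degree functor to `ℕ^k` that has the unique
factorization property. A morphism `f : a ⟶ b` is a path with source `a` and range `b`; the path
usually written `f g` (first `g`, then `f`) is `g ≫ f`. -/
structure KGraph (k : ℕ) where
  Obj : Type u
  [cat : SmallCategory Obj]
  countable : Countable (Σ (a : Obj) (b : Obj), (a ⟶ b))
  degree : ∀ {a b : Obj}, (a ⟶ b) → (Fin k → ℕ)
  degree_id : ∀ a : Obj, degree (𝟙 a) = 0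
  degree_comp : ∀ {a b c : Obj} (g : a ⟶ b) (f : b ⟶ c), degree (g ≫ f) = degree f + degree g
  factorization : ∀ {a b : Obj} (f : a ⟶ b) (n m : Fin k → ℕ), degree f = n + m →
    ∃! y : Σ c : Obj, (c ⟶ b) × (a ⟶ c),
      degree y.2.1 = n ∧ degree y.2.2 = m ∧ y.2.2 ≫ y.2.1 = f

attribute [instance] KGraph.cat

namespace KGraph

variable {k : ℕ}

/-- The paths of a `k`-graph, that is, all its morphisms. -/
structure Path (Λ : KGraph.{u} k) where
  source : Λ.Obj
  range : Λ.Obj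
  hom : source ⟶ range

/-- The degree of a path. -/
def Path.deg {Λ : KGraph.{u} k} (a : Λ.Path) : Fin k → ℕ := Λ.degree a.hom

/-- A morphism as a path. -/
def path (Λ : KGraph.{u} k) {a b : Λ.Obj} (f : a ⟶ b) : Λ.Path := ⟨a, b, f⟩

/-- The path of degree `0` at a vertex. -/
def idPath (Λ : KGraph.{u} k) (v : Λ.Obj) : Λ.Path := Λ.path (𝟙 v)

/-- Row-finite without sources: `0 < |vΛ^n| < ∞` for all vertices `v` and all `n ∈ ℕ^k`. -/
class RowFiniteNoSources (Λ : KGraph.{u} k) : Prop where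
  finite : ∀ (v : Λ.Obj) (n : Fin k → ℕ), {a : Λ.Path | a.range = v ∧ a.deg = n}.Finite
  nonempty : ∀ (v : Λ.Obj) (n : Fin k → ℕ), {a : Λ.Path | a.range = v ∧ a.deg = n}.Nonempty

/-- The vertex `v` is an `e_i`-sink: `Λ^{e_i} v = ∅`. -/
def IsSink (Λ : KGraph.{u} k) (i : Fin k) (v : Λ.Obj) : Prop :=
  {a : Λ.Path | a.source = v ∧ a.deg = Pi.single i 1} = ∅

/-! ### Sink deletion -/

/-- The vertices `w` with `wΛv = ∅`. -/
def Survives (Λ : KGraph.{u} k) (v w : Λ.Obj) : Prop := IsEmpty (v ⟶ w)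

/-- If `r(f)Λv = ∅` then `s(f)Λv = ∅`. -/
theorem Survives.of_hom {Λ : KGraph.{u} k} {v a b : Λ.Obj} (hb : Λ.Survives v b) (f : a ⟶ b) :
    Λ.Survives v a :=
  ⟨fun g => hb.false (g ≫ f)⟩

/-- The category of the paths of `Λ` between vertices `w` with `wΛv = ∅`. -/
abbrev sinkDeletionCat (Λ : KGraph.{u} k) (v : Λ.Obj) :
    SmallCategory {w : Λ.Obj // Λ.Survives v w} where
  Hom a b := a.1 ⟶ b.1
  id a := 𝟙 a.1
  comp f g := f ≫ g

/-- The sink deletion `Λ_S = {f ∈ Λ | r(f)Λv = ∅}`, with the structure of `Λ` restricted to it.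
By `KGraph.Survives.of_hom` the condition on `r(f)` implies the one on `s(f)`, so these paths are
all the paths of `Λ` between vertices `w` with `wΛv = ∅`. -/
def sinkDeletion (Λ : KGraph.{u} k) (v : Λ.Obj) : KGraph.{u} k :=
  letI := Λ.sinkDeletionCat v
  { Obj := {w : Λ.Obj // Λ.Survives v w}
    countable := by
      have := Λ.countable
      refine Function.Injective.countable
        (f := fun y : (Σ (a : {w : Λ.Obj // Λ.Survives v w})
          (b : {w : Λ.Obj // Λ.Survives v w}), (a ⟶ b)) =>
          (⟨y.1.1, y.2.1.1, y.2.2⟩ : Σ (a : Λ.Obj) (b : Λ.Obj), (a ⟶ b))) ?_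
      rintro ⟨⟨a, ha⟩, ⟨b, hb⟩, f⟩ ⟨⟨a', ha'⟩, ⟨b', hb'⟩, f'⟩ h
      simp only [Sigma.mk.injEq] at h
      obtain ⟨rfl, h⟩ := h
      simp only [heq_eq_eq, Sigma.mk.injEq] at h
      obtain ⟨rfl, h⟩ := h
      cases h
      rfl
    degree := fun {a b} f => Λ.degree (a := a.1) (b := b.1) f
    degree_id := fun a => Λ.degree_id a.1
    degree_comp := fun {a b c} g f => Λ.degree_comp (a := a.1) (b := b.1) (c := c.1) g f
    factorization := by
      rintro ⟨a, ha⟩ ⟨b, hb⟩ f n m h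
      obtain ⟨⟨c, f₁, f₂⟩, h₁, h₂⟩ := Λ.factorization (a := a) (b := b) f n m h
      refine ⟨⟨⟨c, hb.of_hom f₁⟩, f₁, f₂⟩, h₁, ?_⟩
      rintro ⟨⟨c', hc'⟩, g₁, g₂⟩ hg
      have := h₂ ⟨c', g₁, g₂⟩ hg
      simp only [Sigma.mk.injEq] at this
      obtain ⟨rfl, this⟩ := this
      cases this
      rfl }

/-- The vertices of the sink deletion are the vertices `w` with `wΛv = ∅`. -/
instance (Λ : KGraph.{u} k) (v : Λ.Obj) [Finite Λ.Obj] : Finite (Λ.sinkDeletion v).Obj :=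
  inferInstanceAs (Finite {w : Λ.Obj // Λ.Survives v w})

/-- The inclusion of paths of the sink deletion. -/
def sinkDeletionIncl (Λ : KGraph.{u} k) (v : Λ.Obj) (a : (Λ.sinkDeletion v).Path) : Λ.Path :=
  ⟨a.source.1, a.range.1, a.hom⟩

theorem sinkDeletionIncl_injective (Λ : KGraph.{u} k) (v : Λ.Obj) :
    Function.Injective (Λ.sinkDeletionIncl v) := by
  rintro ⟨⟨a, ha⟩, ⟨b, hb⟩, f⟩ ⟨⟨a', ha'⟩, ⟨b', hb'⟩, f'⟩ h
  simp only [sinkDeletionIncl] at h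
  cases h
  rfl

/-- As a set of paths, the sink deletion is `{a ∈ Λ | r(a)Λv = ∅}`. -/
theorem range_sinkDeletionIncl (Λ : KGraph.{u} k) (v : Λ.Obj) :
    Set.range (Λ.sinkDeletionIncl v) =
      {a : Λ.Path | {b : Λ.Path | b.range = a.range ∧ b.source = v} = ∅} := by
  ext ⟨a, b, f⟩
  constructor
  · rintro ⟨⟨⟨a', ha⟩, ⟨b', hb⟩, g⟩, h⟩
    simp only [sinkDeletionIncl] at h
    cases h
    refine Set.eq_empty_iff_forall_notMem.2 ?_
    rintro ⟨c, d, e⟩ ⟨h₁, h₂⟩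
    dsimp only at h₁ h₂
    subst h₁ h₂
    exact hb.false e
  · intro h
    have hb : Λ.Survives v b :=
      ⟨fun g => (Set.eq_empty_iff_forall_notMem.1 h) ⟨v, b, g⟩ ⟨rfl, rfl⟩⟩
    exact ⟨⟨⟨a, hb.of_hom f⟩, ⟨b, hb⟩, f⟩, rfl⟩

instance (Λ : KGraph.{u} k) (v : Λ.Obj) [h : Λ.RowFiniteNoSources] :
    (Λ.sinkDeletion v).RowFiniteNoSources where
  finite := by
    rintro ⟨w, hw⟩ n
    refine Set.Finite.of_injOn (f := Λ.sinkDeletionIncl v) ?_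
      (Λ.sinkDeletionIncl_injective v).injOn (h.finite w n)
    rintro a ⟨h₁, h₂⟩
    exact ⟨congrArg Subtype.val h₁, h₂⟩
  nonempty := by
    rintro ⟨w, hw⟩ n
    obtain ⟨⟨a, b, f⟩, h₁, h₂⟩ := h.nonempty w n
    dsimp only at h₁
    subst h₁
    exact ⟨⟨⟨a, hw.of_hom f⟩, ⟨b, hw⟩, f⟩, rfl, h₂⟩

/-! ## Kumjian-Pask algebras -/

/-- The Kumjian-Pask relations between elements `p v`, `s a` and `t a = s_{a^*}` of a ring.
The first two record the convention `s_v = s_{v^*} = p_v` for paths of degree `0`. -/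
inductive KPRel (Λ : KGraph.{u} k) {B : Type x} [NonUnitalRing B]
    (p : Λ.Obj → B) (s t : Λ.Path → B) : B → B → Prop
  | real_id (v : Λ.Obj) : KPRel Λ p s t (s (Λ.idPath v)) (p v)
  | ghost_id (v : Λ.Obj) : KPRel Λ p s t (t (Λ.idPath v)) (p v)
  | kp1_same (v : Λ.Obj) : KPRel Λ p s t (p v * p v) (p v)
  | kp1_ne {v v' : Λ.Obj} (h : v ≠ v') : KPRel Λ p s t (p v * p v') 0
  | kp2_real {a b c : Λ.Obj} (g : a ⟶ b) (f : b ⟶ c) (hg : Λ.degree g ≠ 0)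
      (hf : Λ.degree f ≠ 0) :
      KPRel Λ p s t (s (Λ.path f) * s (Λ.path g)) (s (Λ.path (g ≫ f)))
  | kp2_ghost {a b c : Λ.Obj} (g : a ⟶ b) (f : b ⟶ c) (hg : Λ.degree g ≠ 0)
      (hf : Λ.degree f ≠ 0) :
      KPRel Λ p s t (t (Λ.path g) * t (Λ.path f)) (t (Λ.path (g ≫ f)))
  | kp2_vert_real (a : Λ.Path) (ha : a.deg ≠ 0) : KPRel Λ p s t (p a.range * s a) (s a)
  | kp2_real_vert (a : Λ.Path) (ha : a.deg ≠ 0) : KPRel Λ p s t (s a * p a.source) (s a)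
  | kp2_vert_ghost (a : Λ.Path) (ha : a.deg ≠ 0) : KPRel Λ p s t (p a.source * t a) (t a)
  | kp2_ghost_vert (a : Λ.Path) (ha : a.deg ≠ 0) : KPRel Λ p s t (t a * p a.range) (t a)
  | kp3_same (a : Λ.Path) (ha : a.deg ≠ 0) : KPRel Λ p s t (t a * s a) (p a.source)
  | kp3_ne {a b : Λ.Path} (ha : a.deg ≠ 0) (hd : a.deg = b.deg) (h : a ≠ b) :
      KPRel Λ p s t (t a * s b) 0
  | kp4 (v : Λ.Obj) (n : Fin k → ℕ) (hn : n ≠ 0) (F : Finset Λ.Path)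
      (hF : ∀ a, a ∈ F ↔ a.range = v ∧ a.deg = n) : KPRel Λ p s t (p v) (∑ a ∈ F, s a * t a)

/-- A Kumjian-Pask `Λ`-family: elements of a ring that satisfy the Kumjian-Pask relations. -/
def IsKPFamily (Λ : KGraph.{u} k) {B : Type x} [NonUnitalRing B]
    (p : Λ.Obj → B) (s t : Λ.Path → B) : Prop :=
  ∀ y z, Λ.KPRel p s t y z → y = z

/-- The symbols `p_v`, `s_a`, `s_{a^*}`. -/
inductive KPGen (Λ : KGraph.{u} k) : Type u
  | vert (v : Λ.Obj) : KPGen Λ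
  | real (a : Λ.Path) : KPGen Λ
  | ghost (a : Λ.Path) : KPGen Λ

variable (𝕜 : Type w) [Field 𝕜]

/-- The universal unital `𝕜`-algebra generated by a Kumjian-Pask `Λ`-family. -/
abbrev KPUnital (Λ : KGraph.{u} k) : Type (max u w) :=
  RingQuot (Λ.KPRel (fun v => FreeAlgebra.ι 𝕜 (KPGen.vert v))
    (fun a => FreeAlgebra.ι 𝕜 (KPGen.real a)) (fun a => FreeAlgebra.ι 𝕜 (KPGen.ghost a)))

/-- The generators of `KPUnital`. -/
def kpGen (Λ : KGraph.{u} k) (y : Λ.KPGen) : Λ.KPUnital 𝕜 :=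
  RingQuot.mkAlgHom 𝕜 _ (FreeAlgebra.ι 𝕜 y)

/-- The Kumjian-Pask algebra `KP_𝕜(Λ)`: the universal (not necessarily unital) associative
`𝕜`-algebra generated by a Kumjian-Pask `Λ`-family. It is realized as the subalgebra without unit
generated by the family inside the universal unital algebra; its universal property is
`KGraph.KP.existsUnique_lift`. -/
def KP (Λ : KGraph.{u} k) : Type (max u w) :=
  ↥(NonUnitalAlgebra.adjoin 𝕜 (Set.range (Λ.kpGen 𝕜)))

namespace KP

variable {𝕜} {Λ : KGraph.{u} k}

instance : NonUnitalRing (Λ.KP 𝕜) :=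
  inferInstanceAs (NonUnitalRing ↥(NonUnitalAlgebra.adjoin 𝕜 (Set.range (Λ.kpGen 𝕜))))

instance : Module 𝕜 (Λ.KP 𝕜) :=
  inferInstanceAs (Module 𝕜 ↥(NonUnitalAlgebra.adjoin 𝕜 (Set.range (Λ.kpGen 𝕜))))

instance : IsScalarTower 𝕜 (Λ.KP 𝕜) (Λ.KP 𝕜) :=
  inferInstanceAs (IsScalarTower 𝕜 ↥(NonUnitalAlgebra.adjoin 𝕜 (Set.range (Λ.kpGen 𝕜)))
    ↥(NonUnitalAlgebra.adjoin 𝕜 (Set.range (Λ.kpGen 𝕜))))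

instance : SMulCommClass 𝕜 (Λ.KP 𝕜) (Λ.KP 𝕜) :=
  inferInstanceAs (SMulCommClass 𝕜 ↥(NonUnitalAlgebra.adjoin 𝕜 (Set.range (Λ.kpGen 𝕜)))
    ↥(NonUnitalAlgebra.adjoin 𝕜 (Set.range (Λ.kpGen 𝕜))))

/-- The inclusion of the Kumjian-Pask algebra in the universal unital algebra. -/
def incl : Λ.KP 𝕜 →ₙₐ[𝕜] Λ.KPUnital 𝕜 :=
  NonUnitalSubalgebraClass.subtype (NonUnitalAlgebra.adjoin 𝕜 (Set.range (Λ.kpGen 𝕜)))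

theorem incl_injective : Function.Injective (incl : Λ.KP 𝕜 → Λ.KPUnital 𝕜) :=
  Subtype.val_injective

/-- The generators of the Kumjian-Pask algebra. -/
def gen (y : Λ.KPGen) : Λ.KP 𝕜 :=
  ⟨Λ.kpGen 𝕜 y, NonUnitalAlgebra.subset_adjoin 𝕜 ⟨y, rfl⟩⟩

variable (𝕜)

/-- The generator `p_v`. -/
def p (v : Λ.Obj) : Λ.KP 𝕜 := gen (KPGen.vert v)

/-- The generator `s_a`. -/
def s (a : Λ.Path) : Λ.KP 𝕜 := gen (KPGen.real a)

/-- The generator `s_{a^*}`. -/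
def t (a : Λ.Path) : Λ.KP 𝕜 := gen (KPGen.ghost a)

variable {𝕜}

end KP

theorem KPRel.map {Λ : KGraph.{u} k} {B B' : Type*} [NonUnitalRing B] [NonUnitalRing B']
    {F : Type*} [FunLike F B B'] [NonUnitalRingHomClass F B B'] (φ : F)
    {p : Λ.Obj → B} {s t : Λ.Path → B} {y z : B} (h : Λ.KPRel p s t y z) :
    Λ.KPRel (fun v => φ (p v)) (fun a => φ (s a)) (fun a => φ (t a)) (φ y) (φ z) := by
  cases h <;> ((try simp only [map_mul, map_zero, map_sum]); constructor <;> assumption)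

theorem IsKPFamily.map {Λ : KGraph.{u} k} {B B' : Type*} [NonUnitalRing B] [NonUnitalRing B']
    {F : Type*} [FunLike F B B'] [NonUnitalRingHomClass F B B'] (φ : F)
    {p : Λ.Obj → B} {s t : Λ.Path → B} (h : Λ.IsKPFamily p s t) :
    Λ.IsKPFamily (fun v => φ (p v)) (fun a => φ (s a)) (fun a => φ (t a)) := by
  intro y z hyz
  cases hyz <;> (try simp only [← map_mul, ← map_sum]) <;> (try rw [← map_zero φ]) <;>
    refine congrArg φ (h _ _ ?_) <;> constructor <;> assumption

namespace KP

variable {𝕜} {Λ : KGraph.{u} k}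

/-- The generators of the Kumjian-Pask algebra form a Kumjian-Pask family. -/
theorem isKPFamily : Λ.IsKPFamily (p 𝕜) (s 𝕜) (t 𝕜) := by
  intro y z h
  apply incl_injective
  have h₁ := h.map (incl (𝕜 := 𝕜) (Λ := Λ))
  have h₂ : Λ.IsKPFamily (fun v => Λ.kpGen 𝕜 (KPGen.vert v)) (fun a => Λ.kpGen 𝕜 (KPGen.real a))
      (fun a => Λ.kpGen 𝕜 (KPGen.ghost a)) := by
    intro y z h
    cases h <;> simp only [kpGen, ← map_mul, ← map_sum] <;>
      (try rw [← map_zero (RingQuot.mkAlgHom 𝕜 _)]) <;>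
      refine RingQuot.mkAlgHom_rel 𝕜 ?_ <;> constructor <;> assumption
  exact h₂ _ _ h₁

theorem induction {C : Λ.KP 𝕜 → Prop} (vert : ∀ v, C (p 𝕜 v)) (real : ∀ a, C (s 𝕜 a))
    (ghost : ∀ a, C (t 𝕜 a)) (zero : C 0) (add : ∀ y z, C y → C z → C (y + z))
    (mul : ∀ y z, C y → C z → C (y * z)) (smul : ∀ (r : 𝕜) y, C y → C (r • y))
    (y : Λ.KP 𝕜) : C y := by
  obtain ⟨y, hy⟩ := y
  induction hy using NonUnitalAlgebra.adjoin_induction with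
  | mem y hy =>
    obtain ⟨g, rfl⟩ := hy
    cases g with
    | vert v => exact vert v
    | real a => exact real a
    | ghost a => exact ghost a
  | add y z hy hz h₁ h₂ => exact add _ _ h₁ h₂
  | zero => exact zero
  | mul y z hy hz h₁ h₂ => exact mul _ _ h₁ h₂
  | smul r y hy h => exact smul r _ h

section Lift

variable {B : Type*} [NonUnitalRing B] [Module 𝕜 B] [IsScalarTower 𝕜 B B] [SMulCommClass 𝕜 B B]

theorem exists_lift {p' : Λ.Obj → B} {s' t' : Λ.Path → B} (h : Λ.IsKPFamily p' s' t') :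
    ∃ φ : Λ.KP 𝕜 →ₙₐ[𝕜] B, (∀ v, φ (p 𝕜 v) = p' v) ∧ (∀ a, φ (s 𝕜 a) = s' a) ∧
      ∀ a, φ (t 𝕜 a) = t' a := by
  let g : Λ.KPGen → B := fun y => match y with
    | .vert v => p' v
    | .real a => s' a
    | .ghost a => t' a
  let ψ : FreeAlgebra 𝕜 Λ.KPGen →ₐ[𝕜] Unitization 𝕜 B :=
    FreeAlgebra.lift 𝕜 (fun y => Unitization.inr (g y))
  have hψ : ∀ ⦃y z⦄, Λ.KPRel (fun v => FreeAlgebra.ι 𝕜 (KPGen.vert v))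
      (fun a => FreeAlgebra.ι 𝕜 (KPGen.real a))
      (fun a => FreeAlgebra.ι 𝕜 (KPGen.ghost a)) y z → ψ y = ψ z := by
    intro y z hyz
    have h₁ := hyz.map ψ
    have h₂ := h.map (Unitization.inrNonUnitalAlgHom 𝕜 B)
    refine h₂ _ _ ?_
    simpa [ψ, g] using h₁
  let χ : Λ.KPUnital 𝕜 →ₐ[𝕜] Unitization 𝕜 B := RingQuot.liftAlgHom 𝕜 ⟨ψ, hψ⟩
  have hχ : ∀ y, χ (Λ.kpGen 𝕜 y) = Unitization.inr (g y) := by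
    intro y
    simp [χ, kpGen, ψ]
  have hfst : ∀ y : Λ.KP 𝕜, (χ (incl y)).fst = 0 := by
    intro y
    induction y using KP.induction with
    | vert v => exact congrArg (fun z : Unitization 𝕜 B => z.fst) (hχ (.vert v))
    | real a => exact congrArg (fun z : Unitization 𝕜 B => z.fst) (hχ (.real a))
    | ghost a => exact congrArg (fun z : Unitization 𝕜 B => z.fst) (hχ (.ghost a))
    | zero => simp
    | add y z hy hz => simp [hy, hz]
    | mul y z hy hz => simp [hy, hz]
    | smul r y hy => simp [hy]
  refine ⟨{ toFun := fun y => (χ (incl y)).snd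
            map_smul' := by intro r y; simp
            map_zero' := by simp
            map_add' := by intro y z; simp
            map_mul' := by intro y z; simp [hfst] }, ?_, ?_, ?_⟩
  · intro v
    exact congrArg (fun z : Unitization 𝕜 B => z.snd) (hχ (.vert v))
  · intro a
    exact congrArg (fun z : Unitization 𝕜 B => z.snd) (hχ (.real a))
  · intro a
    exact congrArg (fun z : Unitization 𝕜 B => z.snd) (hχ (.ghost a))

/-- The universal property of the Kumjian-Pask algebra. -/
theorem existsUnique_lift {p' : Λ.Obj → B} {s' t' : Λ.Path → B} (h : Λ.IsKPFamily p' s' t') :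
    ∃! φ : Λ.KP 𝕜 →ₙₐ[𝕜] B, (∀ v, φ (p 𝕜 v) = p' v) ∧ (∀ a, φ (s 𝕜 a) = s' a) ∧
      ∀ a, φ (t 𝕜 a) = t' a := by
  obtain ⟨φ, h₁, h₂, h₃⟩ := exists_lift (𝕜 := 𝕜) h
  refine ⟨φ, ⟨h₁, h₂, h₃⟩, ?_⟩
  rintro χ ⟨g₁, g₂, g₃⟩
  ext y
  induction y using KP.induction with
  | vert v => rw [h₁, g₁]
  | real a => rw [h₂, g₂]
  | ghost a => rw [h₃, g₃]
  | zero => simp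
  | add y z hy hz => simp [hy, hz]
  | mul y z hy hz => simp [hy, hz]
  | smul r y hy => simp [hy]

end Lift

end KP

/-! ### Consequences of the relations -/

theorem eq_idPath {Λ : KGraph.{u} k} (a : Λ.Path) (h : a.deg = 0) :
    a = Λ.idPath a.range ∧ a.source = a.range := by
  obtain ⟨b, c, f⟩ := a
  have h' : Λ.degree f = 0 := h
  have := (Λ.factorization f 0 0 (by simpa using h')).unique
    (y₁ := ⟨b, f, 𝟙 b⟩) (y₂ := ⟨c, 𝟙 c, f⟩) ⟨h', Λ.degree_id b, by simp⟩
    ⟨Λ.degree_id c, h', by simp⟩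
  simp only [Sigma.mk.injEq] at this
  obtain ⟨rfl, this⟩ := this
  simp only [heq_eq_eq, Prod.mk.injEq] at this
  obtain ⟨rfl, -⟩ := this
  exact ⟨rfl, rfl⟩

theorem deg_idPath (Λ : KGraph.{u} k) (v : Λ.Obj) : (Λ.idPath v).deg = 0 := Λ.degree_id v

namespace IsKPFamily

variable {Λ : KGraph.{u} k} {B : Type*} [NonUnitalRing B] {p : Λ.Obj → B} {s t : Λ.Path → B}

theorem real_of_deg_zero (H : Λ.IsKPFamily p s t) {a : Λ.Path} (h : a.deg = 0) : s a = p a.range := by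
  conv_lhs => rw [(eq_idPath a h).1]
  exact H _ _ (.real_id _)

theorem ghost_of_deg_zero (H : Λ.IsKPFamily p s t) {a : Λ.Path} (h : a.deg = 0) : t a = p a.range := by
  conv_lhs => rw [(eq_idPath a h).1]
  exact H _ _ (.ghost_id _)

theorem vert_real (H : Λ.IsKPFamily p s t) (a : Λ.Path) : p a.range * s a = s a := by
  by_cases h : a.deg = 0
  · rw [H.real_of_deg_zero h]; exact H _ _ (.kp1_same _)
  · exact H _ _ (.kp2_vert_real a h)

theorem real_vert (H : Λ.IsKPFamily p s t) (a : Λ.Path) : s a * p a.source = s a := by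
  by_cases h : a.deg = 0
  · rw [H.real_of_deg_zero h, (eq_idPath a h).2]; exact H _ _ (.kp1_same _)
  · exact H _ _ (.kp2_real_vert a h)

theorem vert_ghost (H : Λ.IsKPFamily p s t) (a : Λ.Path) : p a.source * t a = t a := by
  by_cases h : a.deg = 0
  · rw [H.ghost_of_deg_zero h, (eq_idPath a h).2]; exact H _ _ (.kp1_same _)
  · exact H _ _ (.kp2_vert_ghost a h)

theorem ghost_vert (H : Λ.IsKPFamily p s t) (a : Λ.Path) : t a * p a.range = t a := by
  by_cases h : a.deg = 0
  · rw [H.ghost_of_deg_zero h]; exact H _ _ (.kp1_same _)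
  · exact H _ _ (.kp2_ghost_vert a h)

theorem real_comp (H : Λ.IsKPFamily p s t) {a b c : Λ.Obj} (g : a ⟶ b) (f : b ⟶ c) :
    s (Λ.path f) * s (Λ.path g) = s (Λ.path (g ≫ f)) := by
  by_cases hg : Λ.degree g = 0
  · obtain ⟨h, h'⟩ := eq_idPath (Λ.path g) hg
    change a = b at h'
    subst h'
    simp only [path, idPath, Path.mk.injEq, heq_eq_eq, true_and] at h
    subst h
    rw [Category.id_comp, H.real_of_deg_zero (a := Λ.path (𝟙 a)) hg]
    exact H.real_vert (Λ.path f)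
  by_cases hf : Λ.degree f = 0
  · obtain ⟨h, h'⟩ := eq_idPath (Λ.path f) hf
    change b = c at h'
    subst h'
    simp only [path, idPath, Path.mk.injEq, heq_eq_eq, true_and] at h
    subst h
    rw [Category.comp_id, H.real_of_deg_zero (a := Λ.path (𝟙 b)) hf]
    exact H.vert_real (Λ.path g)
  exact H _ _ (.kp2_real g f hg hf)

theorem ghost_comp (H : Λ.IsKPFamily p s t) {a b c : Λ.Obj} (g : a ⟶ b) (f : b ⟶ c) :
    t (Λ.path g) * t (Λ.path f) = t (Λ.path (g ≫ f)) := by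
  by_cases hg : Λ.degree g = 0
  · obtain ⟨h, h'⟩ := eq_idPath (Λ.path g) hg
    change a = b at h'
    subst h'
    simp only [path, idPath, Path.mk.injEq, heq_eq_eq, true_and] at h
    subst h
    rw [Category.id_comp, H.ghost_of_deg_zero (a := Λ.path (𝟙 a)) hg]
    exact H.vert_ghost (Λ.path f)
  by_cases hf : Λ.degree f = 0
  · obtain ⟨h, h'⟩ := eq_idPath (Λ.path f) hf
    change b = c at h'
    subst h'
    simp only [path, idPath, Path.mk.injEq, heq_eq_eq, true_and] at h
    subst h
    rw [Category.comp_id, H.ghost_of_deg_zero (a := Λ.path (𝟙 b)) hf]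
    exact H.ghost_vert (Λ.path g)
  exact H _ _ (.kp2_ghost g f hg hf)

theorem ghost_real_same (H : Λ.IsKPFamily p s t) (a : Λ.Path) : t a * s a = p a.source := by
  by_cases h : a.deg = 0
  · rw [H.ghost_of_deg_zero h, H.real_of_deg_zero h, (eq_idPath a h).2]
    exact H _ _ (.kp1_same _)
  · exact H _ _ (.kp3_same a h)

theorem ghost_real_ne (H : Λ.IsKPFamily p s t) {a b : Λ.Path} (hd : a.deg = b.deg) (hab : a ≠ b) : t a * s b = 0 := by
  by_cases h : a.deg = 0
  · have h' : b.deg = 0 := hd ▸ h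
    rw [H.ghost_of_deg_zero h, H.real_of_deg_zero h']
    refine H _ _ (.kp1_ne fun hr => hab ?_)
    rw [(eq_idPath a h).1, (eq_idPath b h').1, hr]
  · exact H _ _ (.kp3_ne h hd hab)

theorem vert_eq_sum (H : Λ.IsKPFamily p s t) (v : Λ.Obj) (n : Fin k → ℕ) (F : Finset Λ.Path)
    (hF : ∀ a, a ∈ F ↔ a.range = v ∧ a.deg = n) : p v = ∑ a ∈ F, s a * t a := by
  by_cases hn : n = 0
  · subst hn
    have : F = {Λ.idPath v} := by
      ext a
      rw [hF, Finset.mem_singleton]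
      constructor
      · rintro ⟨rfl, h⟩
        exact (eq_idPath a h).1
      · rintro rfl
        exact ⟨rfl, Λ.deg_idPath v⟩
    rw [this, Finset.sum_singleton, H _ _ (.real_id v), H _ _ (.ghost_id v)]
    exact (H _ _ (.kp1_same v)).symm
  · exact H _ _ (.kp4 v n hn F hF)

theorem vert_mul_ne (H : Λ.IsKPFamily p s t) {v v' : Λ.Obj} (h : v ≠ v') : p v * p v' = 0 := H _ _ (.kp1_ne h)

theorem vert_mul_same (H : Λ.IsKPFamily p s t) (v : Λ.Obj) : p v * p v = p v := H _ _ (.kp1_same v)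

/-- Factorization of a path and of the corresponding elements. -/
theorem exists_factor (H : Λ.IsKPFamily p s t) (a : Λ.Path) (n m : Fin k → ℕ) (h : a.deg = n + m) :
    ∃ b c : Λ.Path, b.deg = n ∧ c.deg = m ∧ b.range = a.range ∧ c.range = b.source ∧
      c.source = a.source ∧ s a = s b * s c ∧ t a = t c * t b := by
  obtain ⟨a₁, a₂, f⟩ := a
  obtain ⟨⟨c, f₁, f₂⟩, ⟨h₁, h₂, h₃⟩, -⟩ := Λ.factorization f n m h
  dsimp only at h₁ h₂ h₃
  subst h₃
  exact ⟨Λ.path f₁, Λ.path f₂, h₁, h₂, rfl, rfl, rfl, (H.real_comp _ _).symm,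
    (H.ghost_comp _ _).symm⟩

end IsKPFamily

namespace KP

variable {𝕜} {Λ : KGraph.{u} k}

/-! ### The unit -/

section Unit

variable [Finite Λ.Obj]

/-- For a finite vertex set, the sum of all `p_v`. -/
def unit : Λ.KP 𝕜 :=
  letI := Fintype.ofFinite Λ.Obj
  ∑ v : Λ.Obj, p 𝕜 v

theorem unit_mul_p (v : Λ.Obj) : unit * p 𝕜 v = p 𝕜 v := by
  let := Fintype.ofFinite Λ.Obj
  rw [unit, Finset.sum_mul, Finset.sum_eq_single v, isKPFamily.vert_mul_same]
  · intro w _ h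
    exact isKPFamily.vert_mul_ne h
  · simp

theorem p_mul_unit (v : Λ.Obj) : p 𝕜 v * unit = p 𝕜 v := by
  let := Fintype.ofFinite Λ.Obj
  rw [unit, Finset.mul_sum, Finset.sum_eq_single v, isKPFamily.vert_mul_same]
  · intro w _ h
    exact isKPFamily.vert_mul_ne h.symm
  · simp

theorem unit_mul_and_mul_unit (y : Λ.KP 𝕜) : unit * y = y ∧ y * unit = y := by
  induction y using KP.induction with
  | vert v => exact ⟨unit_mul_p v, p_mul_unit v⟩
  | real a =>
    constructor
    · rw [← isKPFamily.vert_real a, ← mul_assoc, unit_mul_p]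
    · rw [← isKPFamily.real_vert a, mul_assoc, p_mul_unit]
  | ghost a =>
    constructor
    · rw [← isKPFamily.vert_ghost a, ← mul_assoc, unit_mul_p]
    · rw [← isKPFamily.ghost_vert a, mul_assoc, p_mul_unit]
  | zero => simp
  | add y z hy hz => simp [mul_add, add_mul, hy, hz]
  | mul y z hy hz => exact ⟨by rw [← mul_assoc, hy.1], by rw [mul_assoc, hz.2]⟩
  | smul r y hy => simp [mul_smul_comm, smul_mul_assoc, hy]

/-- For a finite vertex set, the Kumjian-Pask algebra has the unit `∑ v, p_v`. -/
instance : Ring (Λ.KP 𝕜) :=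
  { (inferInstance : NonUnitalRing (Λ.KP 𝕜)) with
    one := unit
    one_mul := fun y => (unit_mul_and_mul_unit y).1
    mul_one := fun y => (unit_mul_and_mul_unit y).2 }

theorem one_eq_unit : (1 : Λ.KP 𝕜) = unit := rfl

instance : Algebra 𝕜 (Λ.KP 𝕜) :=
  Algebra.ofModule (fun r y z => smul_mul_assoc r y z) (fun r y z => mul_smul_comm r y z)

end Unit

/-! ### The grading -/

/-- The degree of a path as an element of `ℤ^k`. -/
def zdeg (a : Λ.Path) : Fin k → ℤ := fun i => (a.deg i : ℤ)

variable (𝕜 Λ)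

/-- The component `KP_𝕜(Λ)_n`, spanned by the elements `s_a s_{b^*}` with `s(a) = s(b)` and
`d(a) - d(b) = n`. -/
def component (n : Fin k → ℤ) : Submodule 𝕜 (Λ.KP 𝕜) :=
  Submodule.span 𝕜 {y | ∃ a b : Λ.Path, a.source = b.source ∧ zdeg a - zdeg b = n ∧
    y = s 𝕜 a * t 𝕜 b}

variable {𝕜 Λ}

theorem mem_component {a b : Λ.Path} (h : a.source = b.source) {n : Fin k → ℤ}
    (hn : zdeg a - zdeg b = n) : s 𝕜 a * t 𝕜 b ∈ component 𝕜 Λ n :=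
  Submodule.subset_span ⟨a, b, h, hn, rfl⟩

theorem zdeg_idPath (v : Λ.Obj) : zdeg (Λ.idPath v) = 0 := by
  ext i
  simp [zdeg, deg_idPath]

theorem s_idPath (v : Λ.Obj) : s 𝕜 (Λ.idPath v) = p 𝕜 v := isKPFamily _ _ (.real_id v)

theorem t_idPath (v : Λ.Obj) : t 𝕜 (Λ.idPath v) = p 𝕜 v := isKPFamily _ _ (.ghost_id v)

theorem s_mem (a : Λ.Path) : s 𝕜 a ∈ component 𝕜 Λ (zdeg a) := by
  have := mem_component (𝕜 := 𝕜) (a := a) (b := Λ.idPath a.source) rfl rfl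
  rwa [zdeg_idPath, sub_zero, t_idPath, isKPFamily.real_vert] at this

theorem t_mem (a : Λ.Path) : t 𝕜 a ∈ component 𝕜 Λ (-zdeg a) := by
  have := mem_component (𝕜 := 𝕜) (a := Λ.idPath a.source) (b := a) rfl rfl
  rwa [zdeg_idPath, zero_sub, s_idPath, isKPFamily.vert_ghost] at this

theorem p_mem (v : Λ.Obj) : p 𝕜 v ∈ component 𝕜 Λ 0 := by
  have := s_mem (𝕜 := 𝕜) (Λ.idPath v)
  rwa [zdeg_idPath, s_idPath] at this

theorem s_mul_s_eq_zero {a b : Λ.Path} (h : a.source ≠ b.range) : s 𝕜 a * s 𝕜 b = 0 := by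
  rw [← isKPFamily.real_vert a, ← isKPFamily.vert_real b, mul_assoc, ← mul_assoc (p 𝕜 _) (p 𝕜 _),
    isKPFamily.vert_mul_ne h, zero_mul, mul_zero]

theorem t_mul_t_eq_zero {a b : Λ.Path} (h : a.range ≠ b.source) : t 𝕜 a * t 𝕜 b = 0 := by
  rw [← isKPFamily.ghost_vert a, ← isKPFamily.vert_ghost b, mul_assoc, ← mul_assoc (p 𝕜 _) (p 𝕜 _),
    isKPFamily.vert_mul_ne h, zero_mul, mul_zero]

theorem t_mul_s_eq_zero {a b : Λ.Path} (h : a.range ≠ b.range) : t 𝕜 a * s 𝕜 b = 0 := by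
  rw [← isKPFamily.ghost_vert a, ← isKPFamily.vert_real b, mul_assoc, ← mul_assoc (p 𝕜 _) (p 𝕜 _),
    isKPFamily.vert_mul_ne h, zero_mul, mul_zero]

theorem zdeg_path_comp {a b c : Λ.Obj} (g : a ⟶ b) (f : b ⟶ c) :
    zdeg (Λ.path (g ≫ f)) = zdeg (Λ.path f) + zdeg (Λ.path g) := by
  ext i
  simp [zdeg, path, Path.deg, Λ.degree_comp]

theorem s_mul_mem (a : Λ.Path) {n : Fin k → ℤ} {y : Λ.KP 𝕜} (hy : y ∈ component 𝕜 Λ n) :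
    s 𝕜 a * y ∈ component 𝕜 Λ (zdeg a + n) := by
  induction hy using Submodule.span_induction with
  | mem y hy =>
    obtain ⟨b, c, h, rfl, rfl⟩ := hy
    have H := isKPFamily (𝕜 := 𝕜) (Λ := Λ)
    rw [← mul_assoc]
    by_cases hab : a.source = b.range
    · obtain ⟨a₁, a₂, f⟩ := a
      obtain ⟨b₁, b₂, g⟩ := b
      dsimp only at hab
      subst hab
      have : s 𝕜 (⟨a₁, a₂, f⟩ : Λ.Path) * s 𝕜 (⟨b₁, a₁, g⟩ : Λ.Path) = s 𝕜 (Λ.path (g ≫ f)) :=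
        H.real_comp g f
      rw [this]
      refine mem_component (𝕜 := 𝕜) (a := Λ.path (g ≫ f)) (b := c) h ?_
      rw [zdeg_path_comp, path, path]
      abel
    · rw [s_mul_s_eq_zero hab, zero_mul]
      exact zero_mem _
  | zero => simp
  | add y z _ _ hy hz => rw [mul_add]; exact add_mem hy hz
  | smul r y _ hy => rw [mul_smul_comm]; exact Submodule.smul_mem _ _ hy

theorem mul_t_mem (a : Λ.Path) {n : Fin k → ℤ} {y : Λ.KP 𝕜} (hy : y ∈ component 𝕜 Λ n) :
    y * t 𝕜 a ∈ component 𝕜 Λ (n - zdeg a) := by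
  induction hy using Submodule.span_induction with
  | mem y hy =>
    obtain ⟨b, c, h, rfl, rfl⟩ := hy
    have H := isKPFamily (𝕜 := 𝕜) (Λ := Λ)
    rw [mul_assoc]
    by_cases hab : a.source = c.range
    · obtain ⟨a₁, a₂, f⟩ := a
      obtain ⟨c₁, c₂, g⟩ := c
      dsimp only at hab
      subst hab
      have : t 𝕜 (⟨c₁, a₁, g⟩ : Λ.Path) * t 𝕜 (⟨a₁, a₂, f⟩ : Λ.Path) = t 𝕜 (Λ.path (g ≫ f)) :=
        H.ghost_comp g f
      rw [this]
      refine mem_component (𝕜 := 𝕜) (a := b) (b := Λ.path (g ≫ f)) h ?_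
      rw [zdeg_path_comp, path, path]
      abel
    · rw [t_mul_t_eq_zero (Ne.symm hab), mul_zero]
      exact zero_mem _
  | zero => simp
  | add y z _ _ hy hz => rw [add_mul]; exact add_mem hy hz
  | smul r y _ hy => rw [smul_mul_assoc]; exact Submodule.smul_mem _ _ hy

theorem t_mul_s_mem [hΛ : Λ.RowFiniteNoSources] (a b : Λ.Path) :
    t 𝕜 a * s 𝕜 b ∈ component 𝕜 Λ (zdeg b - zdeg a) := by
  classical
  by_cases hab : a.range = b.range
  · rw [← isKPFamily.vert_real b, isKPFamily.vert_eq_sum b.range (a.deg ⊔ b.deg)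
      (hΛ.finite b.range (a.deg ⊔ b.deg)).toFinset (by simp), Finset.sum_mul, Finset.mul_sum]
    refine sum_mem fun c hc => ?_
    simp only [Set.Finite.mem_toFinset, Set.mem_ofPred_eq] at hc
    obtain ⟨hr, hd⟩ := hc
    obtain ⟨a₁, a₂, ha₁, ha₂, -, h₁, h₂, hs, -⟩ :=
      isKPFamily.exists_factor (p := p 𝕜) (s := s 𝕜) (t := t 𝕜) c a.deg (a.deg ⊔ b.deg - a.deg)
        (by rw [hd, add_tsub_cancel_of_le le_sup_left])
    obtain ⟨b₁, b₂, hb₁, hb₂, -, g₁, g₂, -, ht⟩ :=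
      isKPFamily.exists_factor (p := p 𝕜) (s := s 𝕜) (t := t 𝕜) c b.deg (a.deg ⊔ b.deg - b.deg)
        (by rw [hd, add_tsub_cancel_of_le le_sup_right])
    rw [hs, ht]
    have key : t 𝕜 a * (s 𝕜 a₁ * s 𝕜 a₂ * (t 𝕜 b₂ * t 𝕜 b₁) * s 𝕜 b) =
        (t 𝕜 a * s 𝕜 a₁) * s 𝕜 a₂ * (t 𝕜 b₂ * (t 𝕜 b₁ * s 𝕜 b)) := by
      simp only [mul_assoc]
    rw [key]
    by_cases haa : a = a₁
    · by_cases hbb : b₁ = b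
      · subst haa hbb
        rw [isKPFamily.ghost_real_same, isKPFamily.ghost_real_same, ← h₁, isKPFamily.vert_real,
          ← g₁, isKPFamily.ghost_vert]
        refine mem_component (h₂.trans g₂.symm) ?_
        ext i
        simp only [zdeg, Pi.sub_apply, ha₂, hb₂, Pi.sup_apply]
        have := le_max_left (a.deg i) (b₁.deg i)
        have := le_max_right (a.deg i) (b₁.deg i)
        omega
      · rw [isKPFamily.ghost_real_ne hb₁ hbb, mul_zero, mul_zero]
        exact zero_mem _
    · rw [isKPFamily.ghost_real_ne ha₁.symm haa, zero_mul, zero_mul]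
      exact zero_mem _
  · rw [t_mul_s_eq_zero hab]
    exact zero_mem _

variable [Finite Λ.Obj] [Λ.RowFiniteNoSources]

instance : SetLike.GradedMonoid (component 𝕜 Λ) where
  one_mem := by
    let := Fintype.ofFinite Λ.Obj
    rw [one_eq_unit, unit]
    exact sum_mem fun v _ => p_mem v
  mul_mem := by
    intro n m y z hy hz
    induction hz using Submodule.span_induction with
    | mem z hz =>
      obtain ⟨c, d, -, rfl, rfl⟩ := hz
      induction hy using Submodule.span_induction with
      | mem y hy =>
        obtain ⟨a, b, -, rfl, rfl⟩ := hy
        have h := mul_t_mem d (s_mul_mem a (t_mul_s_mem (𝕜 := 𝕜) b c))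
        have e : s 𝕜 a * t 𝕜 b * (s 𝕜 c * t 𝕜 d) = s 𝕜 a * (t 𝕜 b * s 𝕜 c) * t 𝕜 d := by
          simp only [mul_assoc]
        rw [e]
        convert h using 2
        abel
      | zero => simp
      | add y z _ _ hy hz => rw [add_mul]; exact add_mem hy hz
      | smul r y _ hy => rw [smul_mul_assoc]; exact Submodule.smul_mem _ _ hy
    | zero => simp
    | add y z _ _ hy hz => rw [mul_add]; exact add_mem hy hz
    | smul r y _ hy => rw [mul_smul_comm]; exact Submodule.smul_mem _ _ hy

theorem isKPFamily_of :
    Λ.IsKPFamily (B := ⨁ n, component 𝕜 Λ n)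
      (fun v => DirectSum.of (fun n => component 𝕜 Λ n) 0 ⟨p 𝕜 v, p_mem v⟩)
      (fun a => DirectSum.of (fun n => component 𝕜 Λ n) (zdeg a) ⟨s 𝕜 a, s_mem a⟩)
      (fun a => DirectSum.of (fun n => component 𝕜 Λ n) (-zdeg a) ⟨t 𝕜 a, t_mem a⟩) := by
  have hof : ∀ {n m : Fin k → ℤ} {y z : Λ.KP 𝕜} (hy : y ∈ component 𝕜 Λ n)
      (hz : z ∈ component 𝕜 Λ m), n = m → y = z →
      DirectSum.of (fun n => component 𝕜 Λ n) n ⟨y, hy⟩ =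
        DirectSum.of (fun n => component 𝕜 Λ n) m ⟨z, hz⟩ := by
    rintro n m y z hy hz rfl rfl
    rfl
  have hof0 : ∀ {n : Fin k → ℤ} {y : Λ.KP 𝕜} (hy : y ∈ component 𝕜 Λ n), y = 0 →
      DirectSum.of (fun n => component 𝕜 Λ n) n ⟨y, hy⟩ = 0 := by
    rintro n y hy rfl
    exact map_zero (DirectSum.of (fun n => component 𝕜 Λ n) n)
  have hmul : ∀ {n m : Fin k → ℤ} {y z : Λ.KP 𝕜} (hy : y ∈ component 𝕜 Λ n)
      (hz : z ∈ component 𝕜 Λ m),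
      DirectSum.of (fun n => component 𝕜 Λ n) n ⟨y, hy⟩ *
        DirectSum.of (fun n => component 𝕜 Λ n) m ⟨z, hz⟩ =
        DirectSum.of (fun n => component 𝕜 Λ n) (n + m) ⟨y * z, SetLike.mul_mem_graded hy hz⟩ := by
    intro n m y z hy hz
    exact DirectSum.of_mul_of _ _
  intro y z h
  have H := isKPFamily (𝕜 := 𝕜) (Λ := Λ)
  cases h with
  | real_id v => exact hof _ _ (zdeg_idPath v) (s_idPath v)
  | ghost_id v => exact hof _ _ (by rw [zdeg_idPath, neg_zero]) (t_idPath v)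
  | kp1_same v => rw [hmul]; exact hof _ _ (add_zero 0) (H.vert_mul_same v)
  | kp1_ne h => rw [hmul]; exact hof0 _ (H.vert_mul_ne h)
  | kp2_real g f => rw [hmul]; exact hof _ _ (zdeg_path_comp g f).symm (H.real_comp g f)
  | kp2_ghost g f =>
    rw [hmul]
    exact hof _ _ (by rw [zdeg_path_comp]; abel) (H.ghost_comp g f)
  | kp2_vert_real a => rw [hmul]; exact hof _ _ (zero_add _) (H.vert_real a)
  | kp2_real_vert a => rw [hmul]; exact hof _ _ (add_zero _) (H.real_vert a)
  | kp2_vert_ghost a => rw [hmul]; exact hof _ _ (zero_add _) (H.vert_ghost a)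
  | kp2_ghost_vert a => rw [hmul]; exact hof _ _ (add_zero _) (H.ghost_vert a)
  | kp3_same a => rw [hmul]; exact hof _ _ (neg_add_cancel _) (H.ghost_real_same a)
  | kp3_ne ha hd h => rw [hmul]; exact hof0 _ (H.ghost_real_ne hd h)
  | kp4 v n hn F hF =>
    have h₁ : ∀ a : Λ.Path, s 𝕜 a * t 𝕜 a ∈ component 𝕜 Λ 0 := fun a =>
      mem_component rfl (sub_self _)
    have h₂ : ∀ a : Λ.Path, DirectSum.of (fun n => component 𝕜 Λ n) (zdeg a) ⟨s 𝕜 a, s_mem a⟩ *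
        DirectSum.of (fun n => component 𝕜 Λ n) (-zdeg a) ⟨t 𝕜 a, t_mem a⟩ =
        DirectSum.of (fun n => component 𝕜 Λ n) 0 ⟨s 𝕜 a * t 𝕜 a, h₁ a⟩ := by
      intro a
      rw [hmul]
      exact hof _ _ (add_neg_cancel _) rfl
    simp only [h₂]
    rw [← map_sum]
    congr 1
    ext
    simp only [AddSubmonoidClass.coe_finsetSum]
    exact H.vert_eq_sum v n F hF

/-- The Kumjian-Pask algebra is `ℤ^k`-graded by its components. -/
instance gradedAlgebra : GradedAlgebra (component 𝕜 Λ) := by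
  have hφ := exists_lift (𝕜 := 𝕜) (isKPFamily_of (𝕜 := 𝕜) (Λ := Λ))
  let φ := hφ.choose
  obtain ⟨h₁, h₂, h₃⟩ := hφ.choose_spec
  let ψ : Λ.KP 𝕜 →ₐ[𝕜] ⨁ n, component 𝕜 Λ n := AlgHom.ofLinearMap
    { toFun := φ, map_add' := map_add φ, map_smul' := map_smul φ }
    (by
      let := Fintype.ofFinite Λ.Obj
      change φ 1 = 1
      rw [one_eq_unit, unit, map_sum, Finset.sum_congr rfl fun v _ => h₁ v, ← map_sum,
        DirectSum.one_def]
      congr 1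
      ext
      simp only [AddSubmonoidClass.coe_finsetSum]
      rfl)
    (fun y z => map_mul φ y z)
  refine GradedAlgebra.ofAlgHom _ ψ ?_ ?_
  · ext y
    change DirectSum.coeAlgHom (component 𝕜 Λ) (φ y) = y
    induction y using KP.induction with
    | vert v => rw [h₁, DirectSum.coeAlgHom_of]
    | real a => rw [h₂, DirectSum.coeAlgHom_of]
    | ghost a => rw [h₃, DirectSum.coeAlgHom_of]
    | zero => simp
    | add y z hy hz => rw [map_add, map_add, hy, hz]
    | mul y z hy hz => rw [map_mul, map_mul, hy, hz]
    | smul r y hy => rw [map_smul, map_smul, hy]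
  · rintro n ⟨y, hy⟩
    change φ y = _
    induction hy using Submodule.span_induction with
    | mem y hy =>
      obtain ⟨a, b, h, rfl, rfl⟩ := hy
      rw [map_mul, h₂, h₃, DirectSum.of_mul_of]
      refine DirectSum.of_eq_of_gradedMonoid_eq (Sigma.subtype_ext ?_ rfl)
      exact (sub_eq_add_neg _ _).symm
    | zero => rw [map_zero]; exact (map_zero (DirectSum.of (fun n => component 𝕜 Λ n) n)).symm
    | add y z h₁ h₂ hy hz => rw [map_add, hy, hz, ← map_add]; rfl
    | smul r y h hy =>
      rw [map_smul, hy]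
      exact (map_smul (DirectSum.lof 𝕜 _ (fun n => component 𝕜 Λ n) n) r ⟨y, h⟩).symm

end KP

end KGraph

/-! ## Graded Morita equivalence -/

/-- A `Γ`-graded right module over a ring `A` graded by `𝒜`: a right `A`-module `M`, direct sum
of subgroups `M_γ` with `M_γ A_δ ⊆ M_{γ + δ}`. -/
structure GrMod {Γ : Type*} [AddCommGroup Γ] [DecidableEq Γ] {A : Type x} [Ring A] {σ : Type*}
    [SetLike σ A] (𝒜 : Γ → σ) where
  carrier : Type x
  [addCommGroup : AddCommGroup carrier]
  [module : Module Aᵐᵒᵖ carrier]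
  comp : Γ → AddSubgroup carrier
  isInternal : DirectSum.IsInternal comp
  smul_mem : ∀ {γ δ : Γ} {m : carrier} {a : A}, m ∈ comp γ → a ∈ 𝒜 δ →
    MulOpposite.op a • m ∈ comp (γ + δ)

namespace GrMod

attribute [instance] GrMod.addCommGroup GrMod.module

variable {Γ : Type*} [AddCommGroup Γ] [DecidableEq Γ] {A : Type x} [Ring A] {σ : Type*}
  [SetLike σ A] {𝒜 : Γ → σ}

/-- Homomorphisms of graded modules: module homomorphisms that preserve degrees. -/
@[ext]
structure Hom (M N : GrMod 𝒜) where
  hom : M.carrier →ₗ[Aᵐᵒᵖ] N.carrier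
  map_mem : ∀ {γ : Γ} {m : M.carrier}, m ∈ M.comp γ → hom m ∈ N.comp γ

/-- The category `Gr-A` of graded right modules. -/
instance : Category (GrMod 𝒜) where
  Hom M N := Hom M N
  id M := ⟨LinearMap.id, fun h => h⟩
  comp f g := ⟨g.hom ∘ₗ f.hom, fun h => g.map_mem (f.map_mem h)⟩

@[ext]
theorem hom_ext {M N : GrMod 𝒜} {f g : M ⟶ N} (h : ∀ m, f.hom m = g.hom m) : f = g :=
  Hom.ext (LinearMap.ext h)

@[simp]
theorem id_hom_apply (M : GrMod 𝒜) (m : M.carrier) : Hom.hom (𝟙 M) m = m := rfl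

@[simp]
theorem comp_hom_apply {M N P : GrMod 𝒜} (f : M ⟶ N) (g : N ⟶ P) (m : M.carrier) :
    (f ≫ g).hom m = g.hom (f.hom m) := rfl

/-- The shifted module `M(α)`: the module `M` with `M(α)_γ = M_{α + γ}`. -/
def shift (α : Γ) (M : GrMod 𝒜) : GrMod 𝒜 where
  carrier := M.carrier
  comp γ := M.comp (α + γ)
  isInternal := by
    have h := M.isInternal
    let e := DirectSum.equivCongrLeft (β := fun γ => M.comp γ) (Equiv.addLeft α).symm
    have he : (DirectSum.coeAddMonoidHom fun γ => M.comp (α + γ)).comp e.toAddMonoidHom =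
        DirectSum.coeAddMonoidHom M.comp := by
      refine DirectSum.addHom_ext fun γ m => ?_
      obtain ⟨γ, rfl⟩ := (Equiv.addLeft α).surjective γ
      have := DirectSum.equivCongrLeft_of (β := fun γ => M.comp γ) (Equiv.addLeft α).symm γ m
      refine (congrArg (DirectSum.coeAddMonoidHom fun γ => M.comp (α + γ)) this).trans ?_
      exact (DirectSum.coeAddMonoidHom_of (fun γ => M.comp (α + γ)) γ m).trans
        (DirectSum.coeAddMonoidHom_of M.comp (α + γ) m).symm
    have h' : Function.Bijective
        ((DirectSum.coeAddMonoidHom fun γ => M.comp (α + γ)) ∘ e) := by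
      have : ((DirectSum.coeAddMonoidHom fun γ => M.comp (α + γ)) ∘ e : _ → M.carrier) =
          DirectSum.coeAddMonoidHom M.comp := by
        ext m
        exact DFunLike.congr_fun he m
      rw [this]
      exact h
    exact (Function.Bijective.of_comp_iff _ e.bijective).1 h'
  smul_mem hm ha := by
    rw [← add_assoc]
    exact M.smul_mem hm ha

variable (𝒜) in
/-- The shift functor `T_α : M ↦ M(α)`, the identity on underlying maps. -/
def shiftFun (α : Γ) : GrMod 𝒜 ⥤ GrMod 𝒜 where
  obj M := M.shift α
  map f := ⟨f.hom, fun h => f.map_mem h⟩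

/-- The identification `M(0) = M`. -/
def shiftZero (M : GrMod 𝒜) : M.shift (0 : Γ) ≅ M where
  hom := ⟨LinearMap.id, fun {γ m} hm => (zero_add γ) ▸ (show m ∈ M.comp (0 + γ) from hm)⟩
  inv := ⟨LinearMap.id, fun {γ m} hm => show m ∈ M.comp (0 + γ) from (zero_add γ).symm ▸ hm⟩

/-- The identification `M(α + β) = M(α)(β)`. -/
def shiftAdd (α β : Γ) (M : GrMod 𝒜) : M.shift (α + β) ≅ (M.shift α).shift β where
  hom := ⟨LinearMap.id, fun {γ m} hm => show m ∈ M.comp (α + (β + γ)) from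
    (add_assoc α β γ) ▸ (show m ∈ M.comp (α + β + γ) from hm)⟩
  inv := ⟨LinearMap.id, fun {γ m} hm => show m ∈ M.comp (α + β + γ) from
    (add_assoc α β γ).symm ▸ (show m ∈ M.comp (α + (β + γ)) from hm)⟩

@[simp]
theorem eqToHom_shift_hom_apply {α β : Γ} (h : α = β) (M : GrMod 𝒜)
    (h' : M.shift α = M.shift β) (m : M.carrier) : Hom.hom (eqToHom h') m = m := by
  subst h
  rfl

/-- The shifts on `Gr-A`; the identifications `M(0) = M` and `M(α + β) = M(α)(β)` are the
identity maps. -/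
instance : HasShift (GrMod 𝒜) Γ :=
  hasShiftMk (GrMod 𝒜) Γ
    { F := shiftFun 𝒜
      zero := NatIso.ofComponents
        (fun M => M.shiftZero) (fun f => rfl)
      add := fun α β => NatIso.ofComponents
        (fun M => M.shiftAdd α β) (fun f => rfl)
      assoc_hom_app := fun α β γ M => by
        ext m
        exact (eqToHom_shift_hom_apply (add_assoc α β γ) M _ m).symm
      zero_add_hom_app := fun α M => by
        ext m
        exact (eqToHom_shift_hom_apply (zero_add α) M _ m).symm
      add_zero_hom_app := fun α M => by
        ext m
        exact (eqToHom_shift_hom_apply (add_zero α) M _ m).symm }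

end GrMod

/-- Graded rings `A` and `B` are graded Morita equivalent if there is an equivalence of categories
`Gr-A → Gr-B` that commutes with the shift functors. -/
def GradedMoritaEquivalent {Γ : Type*} [AddCommGroup Γ] [DecidableEq Γ] {A B : Type x} [Ring A]
    [Ring B] {σ τ : Type*} [SetLike σ A] [AddSubmonoidClass σ A] [SetLike τ B]
    [AddSubmonoidClass τ B] (𝒜 : Γ → σ) (ℬ : Γ → τ) [GradedRing 𝒜] [GradedRing ℬ] : Prop :=
  ∃ F : GrMod 𝒜 ⥤ GrMod ℬ, F.IsEquivalence ∧ Nonempty (F.CommShift Γ)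

end

noncomputable section

set_option linter.unusedSectionVars false

/-! Write `A` and `B` for the Kumjian-Pask algebras of `Λ` and of the sink deletion. The inclusion
of paths induces a graded homomorphism `φ : B → A`, unital only onto the corner at `φ(1)`, the sum
of `p_u` over the surviving vertices. The proof shows that `φ` identifies `B` with the full corner
`φ(1) A φ(1)`; graded Morita theory does the rest.

The image is the corner because a path whose range survives lies entirely in the sink deletion, so
cutting `s_a s_{b^*}` down by `φ(1)` returns it from `B` or kills it (`exists_inclHom_eq`).

The corner is full because every path of degree `e_i` has a surviving source: if `v` reached that
source along `f`, refactoring `a f` with a second factor of degree `e_i` would give a path of degree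
`e_i` with source `v` (`IsSink.survives_source`). Hence `1 = ∑ s_a s_{a^*}` over the paths of degree
`e_i`, with `s_a ∈ A φ(1)` and `s_{a^*} ∈ φ(1) A`.

Injectivity of `φ` is proved without a uniqueness theorem. The matrix `(s_{x^*} a s_y)`, with `x`,
`y` of degree `e_i`, ought to have entries in `B`; for `a = s_λ` they are read off from the
commuting squares `λ l = l' b`. These matrices form a Kumjian-Pask family over `B`
(`isKPFamily_matrix`), hence define a homomorphism on `A`. Its composite with `φ` is conjugation by
the paths of degree `e_i` inside `B`, from which `b` is recovered (`inclHom_injective`).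

For the Morita part, `M ↦ M φ(1)` commutes with the shifts by identity maps. A relation `∑ x_j y_j =
1` with homogeneous `x_j ∈ A φ(1)` and `y_j ∈ φ(1) A` encodes a module `M` by the tuples `(m
x_j)_j`, on which `a` acts by the matrix `(y_j a x_l)`. This makes the functor fully faithful and
shows how to induce modules from `B` to `A`. -/

/-- The homogeneous parts of `m` are obtained by decomposing each `f j m` and mapping back by `g j`.
This grades both the corner of a module (one index) and the induced module (one index for each
`x_j`). -/
theorem DirectSum.isInternal_of_retract {Γ ι M : Type*} [DecidableEq Γ] [Fintype ι]
    [AddCommGroup M] (ℳ : Γ → AddSubgroup M) {N : ι → Type*} [∀ j, AddCommGroup (N j)]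
    (𝒩 : ∀ j, Γ → AddSubgroup (N j)) (h𝒩 : ∀ j, IsInternal (𝒩 j)) (f : ∀ j, M →+ N j)
    (g : ∀ j, N j →+ M) (hf : ∀ j γ m, m ∈ ℳ γ → f j m ∈ 𝒩 j γ)
    (hg : ∀ j γ n, n ∈ 𝒩 j γ → g j n ∈ ℳ γ) (hfg : ∀ m, ∑ j, g j (f j m) = m) :
    IsInternal ℳ := by
  let := fun j => (h𝒩 j).chooseDecomposition
  let G : ∀ j, (⨁ γ, 𝒩 j γ) →+ ⨁ γ, ℳ γ := fun j =>
    DirectSum.map fun γ => ((g j).comp (𝒩 j γ).subtype).codRestrict (ℳ γ)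
      (fun n => hg j γ n n.2)
  let D : M →+ ⨁ γ, ℳ γ :=
    ∑ j, (G j).comp ((decomposeAddEquiv (𝒩 j)).toAddMonoidHom.comp (f j))
  have hG : ∀ j y, DirectSum.coeAddMonoidHom ℳ (G j y) =
      g j (DirectSum.coeAddMonoidHom (𝒩 j) y) := by
    intro j y
    refine DFunLike.congr_fun (f := (DirectSum.coeAddMonoidHom ℳ).comp (G j))
      (g := (g j).comp (DirectSum.coeAddMonoidHom (𝒩 j))) ?_ y
    refine DirectSum.addHom_ext fun γ n => ?_
    simp only [G, AddMonoidHom.comp_apply, map_of, coeAddMonoidHom_of]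
    rfl
  refine Function.bijective_iff_has_inverse.2 ⟨D, fun y => ?_, fun m => ?_⟩
  · refine DFunLike.congr_fun (f := D.comp (DirectSum.coeAddMonoidHom ℳ))
      (g := AddMonoidHom.id _) ?_ y
    refine DirectSum.addHom_ext fun γ m => ?_
    have h : ∀ j, decompose (𝒩 j) (f j m) = DirectSum.of (fun γ => 𝒩 j γ) γ
        ⟨f j m, hf j γ m m.2⟩ := fun j => decompose_of_mem (𝒩 j) (hf j γ m m.2)
    have h' : D m = ∑ j, DirectSum.of (fun γ => ℳ γ) γ
        ⟨g j (f j m), hg j γ _ (hf j γ m m.2)⟩ := by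
      simp only [D, AddMonoidHom.finsetSum_apply]
      refine Finset.sum_congr rfl fun j _ => ?_
      change G j (decompose (𝒩 j) (f j m)) = _
      rw [h]
      exact DirectSum.map_of _ _ _
    simp only [AddMonoidHom.comp_apply, coeAddMonoidHom_of, AddMonoidHom.id_apply]
    rw [h', ← map_sum]
    congr 1
    ext
    rw [AddSubmonoidClass.coe_finsetSum]
    exact hfg m
  · simp only [D, AddMonoidHom.finsetSum_apply, map_sum]
    refine (Finset.sum_congr rfl fun j _ => ?_).trans (hfg m)
    refine (hG j (decompose (𝒩 j) (f j m))).trans (congrArg (g j) ?_)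
    exact (decompose (𝒩 j)).symm_apply_apply (f j m)

/-! ### The corner functor `M ↦ M φ(1)` and its compatibility with shifts -/

namespace GrMod

open MulOpposite

variable {Γ : Type*} [AddCommGroup Γ] [DecidableEq Γ] {A B : Type x} [Ring A] [Ring B]
  {σ τ : Type*} [SetLike σ A] [SetLike τ B] {𝒜 : Γ → σ} {ℬ : Γ → τ}

theorem smul_mem_of_eq (M : GrMod 𝒜) {γ δ ε : Γ} {m : M.carrier} {a : A} (hm : m ∈ M.comp γ)
    (ha : a ∈ 𝒜 δ) (h : γ + δ = ε) : op a • m ∈ M.comp ε :=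
  h ▸ M.smul_mem hm ha

/-- For a ring homomorphism `φ : B → A` that need not preserve the unit, the subgroup `M φ(1)` of
a right `A`-module `M`. -/
def corner (φ : B →ₙ+* A) (M : GrMod 𝒜) : AddSubgroup M.carrier where
  carrier := {m | op (φ 1) • m = m}
  zero_mem' := smul_zero _
  add_mem' {m n} hm hn := by
    rw [Set.mem_ofPred_eq] at *
    rw [smul_add, hm, hn]
  neg_mem' {m} hm := by
    rw [Set.mem_ofPred_eq] at *
    rw [smul_neg, hm]

theorem mem_corner {φ : B →ₙ+* A} {M : GrMod 𝒜} {m : M.carrier} :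
    m ∈ corner φ M ↔ op (φ 1) • m = m := Iff.rfl

theorem smul_mem_corner (φ : B →ₙ+* A) (M : GrMod 𝒜) {a : A} (ha : a * φ 1 = a) (m : M.carrier) :
    op a • m ∈ corner φ M := by
  rw [mem_corner, smul_smul, ← op_mul, ha]

/-- The action through `φ` is unital exactly because `φ 1` fixes the elements of the corner. -/
instance (φ : B →ₙ+* A) (M : GrMod 𝒜) : Module Bᵐᵒᵖ (corner φ M) where
  smul b m := ⟨op (φ b.unop) • m.1,
    smul_mem_corner φ M (by rw [← map_mul, mul_one]) m.1⟩
  one_smul m := Subtype.ext m.2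
  mul_smul b c m := Subtype.ext <| by
    change op (φ (c.unop * b.unop)) • m.1 = op (φ b.unop) • op (φ c.unop) • m.1
    rw [map_mul, op_mul, mul_smul]
  smul_zero b := Subtype.ext (smul_zero _)
  smul_add b m n := Subtype.ext (smul_add _ _ _)
  add_smul b c m := Subtype.ext <| by
    change op (φ (b.unop + c.unop)) • m.1 = op (φ b.unop) • m.1 + op (φ c.unop) • m.1
    rw [map_add]
    exact add_smul _ _ _
  zero_smul m := Subtype.ext <| by
    change op (φ 0) • m.1 = 0
    rw [map_zero, op_zero, zero_smul]

theorem coe_op_smul_corner (φ : B →ₙ+* A) (M : GrMod 𝒜) (b : B) (m : corner φ M) :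
    ((op b • m : corner φ M) : M.carrier) = op (φ b) • m.1 := rfl

/-- This and the next three lemmas unfold the coherence isomorphisms of the shift to identity maps
on elements, which is all that the axioms of `CommShift` need below. -/
theorem shiftFunctorZero_hom_app_apply (M : GrMod 𝒜) (m : M.carrier) :
    Hom.hom ((shiftFunctorZero (GrMod 𝒜) Γ).hom.app M) m = m := by
  rw [ShiftMkCore.shiftFunctorZero_eq]
  rfl

theorem shiftFunctorZero_inv_app_apply (M : GrMod 𝒜) (m : M.carrier) :
    Hom.hom ((shiftFunctorZero (GrMod 𝒜) Γ).inv.app M) m = m := by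
  rw [ShiftMkCore.shiftFunctorZero_eq]
  rfl

theorem shiftFunctorAdd_hom_app_apply (α β : Γ) (M : GrMod 𝒜) (m : M.carrier) :
    Hom.hom ((shiftFunctorAdd (GrMod 𝒜) α β).hom.app M) m = m := by
  rw [ShiftMkCore.shiftFunctorAdd_eq]
  rfl

theorem shiftFunctorAdd_inv_app_apply (α β : Γ) (M : GrMod 𝒜) (m : M.carrier) :
    Hom.hom ((shiftFunctorAdd (GrMod 𝒜) α β).inv.app M) m = m := by
  rw [ShiftMkCore.shiftFunctorAdd_eq]
  rfl

section Functor

variable [AddSubmonoidClass τ B] [GradedRing ℬ]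

/-- The functor `M ↦ M φ(1)` from `Gr-A` to `Gr-B`. -/
def cornerFunctor (φ : B →ₙ+* A) (hφ : ∀ γ b, b ∈ ℬ γ → φ b ∈ 𝒜 γ) : GrMod 𝒜 ⥤ GrMod ℬ where
  obj M :=
    { carrier := corner φ M
      comp := fun γ => (M.comp γ).comap (corner φ M).subtype
      isInternal := by
        have h1 : φ 1 ∈ 𝒜 0 := hφ 0 1 SetLike.GradedOne.one_mem
        -- `m ↦ m φ(1)` retracts `M` onto the corner and preserves degrees, since `φ 1` has degree
        -- `0`.
        refine isInternal_of_retract (ι := Unit) _ (fun _ => M.comp) (fun _ => M.isInternal)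
          (fun _ => (corner φ M).subtype)
          (fun _ => (DistribSMul.toAddMonoidHom M.carrier (op (φ 1))).codRestrict (corner φ M)
            fun m => smul_mem_corner φ M (by rw [← map_mul, mul_one]) m)
          (fun _ _ _ hm => hm) (fun _ γ m hm => M.smul_mem_of_eq hm h1 (add_zero γ)) ?_
        intro m
        rw [Fintype.sum_unique]
        exact Subtype.ext m.2
      smul_mem := fun {γ δ m b} hm hb => M.smul_mem hm (hφ δ b hb) }
  map {M N} f :=
    { hom :=
        { toFun := fun m => ⟨f.hom m.1, by rw [mem_corner, ← map_smul, mem_corner.1 m.2]⟩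
          map_add' := fun m n => Subtype.ext (map_add f.hom m.1 n.1)
          map_smul' := fun b m => Subtype.ext (map_smul f.hom (op (φ b.unop)) m.1) }
      map_mem := fun hm => f.map_mem hm }

variable (φ : B →ₙ+* A) (hφ : ∀ γ b, b ∈ ℬ γ → φ b ∈ 𝒜 γ)

/-- The functor `M ↦ M φ(1)` commutes with the shifts. -/
def cornerShiftIso (α : Γ) :
    shiftFunctor (GrMod 𝒜) α ⋙ cornerFunctor φ hφ ≅ cornerFunctor φ hφ ⋙ shiftFunctor (GrMod ℬ) α :=
  NatIso.ofComponents
    (fun M =>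
      { hom := ⟨LinearMap.id (R := Bᵐᵒᵖ) (M := corner φ M), fun hm => hm⟩
        inv := ⟨LinearMap.id (R := Bᵐᵒᵖ) (M := corner φ M), fun hm => hm⟩ })
    (fun f => rfl)

instance : (cornerFunctor φ hφ).CommShift Γ where
  commShiftIso := cornerShiftIso φ hφ
  commShiftIso_zero := by
    ext M m
    rw [Functor.CommShift.isoZero_hom_app]
    refine Subtype.ext (Eq.symm ?_)
    exact (congrArg (Subtype.val : corner φ M → M.carrier)
      (shiftFunctorZero_inv_app_apply ((cornerFunctor φ hφ).obj M) _)).trans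
      (shiftFunctorZero_hom_app_apply M (m : corner φ M).1)
  commShiftIso_add := by
    intro α β
    ext M m
    rw [Functor.CommShift.isoAdd_hom_app]
    refine Subtype.ext (Eq.symm ?_)
    exact (congrArg (Subtype.val : corner φ M → M.carrier)
      (shiftFunctorAdd_inv_app_apply α β ((cornerFunctor φ hφ).obj M) _)).trans
      (shiftFunctorAdd_hom_app_apply α β M (m : corner φ M).1)

end Functor

end GrMod

/-! ### Graded Morita theory of a full corner -/

namespace GrMod

open MulOpposite

variable {Γ : Type*} [AddCommGroup Γ] [DecidableEq Γ] {A B : Type x} [Ring A] [Ring B]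
  {σ τ : Type*} [SetLike σ A] [SetLike τ B]

/-- An isomorphism `φ` of a graded ring `B` with a corner `φ(1) A φ(1)` of a graded ring `A`,
together with homogeneous elements that witness that the idempotent `φ(1)` is full. -/
structure FullCorner (𝒜 : Γ → σ) (ℬ : Γ → τ) (ι : Type) [Fintype ι] where
  φ : B →ₙ+* A
  map_mem : ∀ γ b, b ∈ ℬ γ → φ b ∈ 𝒜 γ
  injective : Function.Injective φ
  exists_mem : ∀ γ a, a ∈ 𝒜 γ → ∃ b ∈ ℬ γ, φ b = φ 1 * a * φ 1
  d : ι → Γ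
  x : ι → A
  y : ι → A
  x_mem : ∀ j, x j ∈ 𝒜 (d j)
  y_mem : ∀ j, y j ∈ 𝒜 (-d j)
  x_mul_one : ∀ j, x j * φ 1 = x j
  one_mul_y : ∀ j, φ 1 * y j = y j
  sum_x_mul_y : ∑ j, x j * y j = 1

namespace FullCorner

variable {𝒜 : Γ → σ} {ℬ : Γ → τ} {ι : Type} [Fintype ι]

section

variable (C : FullCorner 𝒜 ℬ ι)

theorem one_mul_map (b : B) : C.φ 1 * C.φ b = C.φ b := by rw [← map_mul, one_mul]

theorem map_mul_one (b : B) : C.φ b * C.φ 1 = C.φ b := by rw [← map_mul, mul_one]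

theorem sum_mul_x_mul_y (a : A) : ∑ j, a * C.x j * C.y j = a := by
  simp only [mul_assoc]
  rw [← Finset.mul_sum, C.sum_x_mul_y, mul_one]

theorem sum_smul_smul (M : GrMod 𝒜) (m : M.carrier) : ∑ j, op (C.y j) • op (C.x j) • m = m := by
  simp only [smul_smul, ← op_mul]
  rw [← Finset.sum_smul, ← Finset.op_sum, C.sum_x_mul_y, op_one, one_smul]

/-- The map `m ↦ m x_j` from `M` to `M φ(1)`. -/
def toCorner (M : GrMod 𝒜) (j : ι) : M.carrier →+ corner C.φ M :=
  (DistribSMul.toAddMonoidHom M.carrier (op (C.x j))).codRestrict (corner C.φ M)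
    (smul_mem_corner C.φ M (C.x_mul_one j))

theorem coe_toCorner (M : GrMod 𝒜) (j : ι) (m : M.carrier) :
    (C.toCorner M j m).1 = op (C.x j) • m := rfl

end

section

variable [AddSubmonoidClass σ A] [GradedRing 𝒜] (C : FullCorner 𝒜 ℬ ι)

/-- The corner condition is assumed for homogeneous elements only; additivity extends it to all of
`A`. -/
theorem exists_map_eq (a : A) : ∃ b, C.φ b = C.φ 1 * a * C.φ 1 := by
  induction a using DirectSum.Decomposition.inductionOn 𝒜 with
  | zero => exact ⟨0, by simp⟩
  | homogeneous a =>
    obtain ⟨b, -, hb⟩ := C.exists_mem _ _ a.2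
    exact ⟨b, hb⟩
  | add a a' h h' =>
    obtain ⟨b, hb⟩ := h
    obtain ⟨b', hb'⟩ := h'
    exact ⟨b + b', by rw [map_add, hb, hb', mul_add, add_mul]⟩

/-- The map `a ↦ φ⁻¹(φ(1) a φ(1))`. -/
def ρ : A →+ B :=
  AddMonoidHom.mk' (fun a => (C.exists_map_eq a).choose) fun a a' => C.injective <| by
    rw [map_add, (C.exists_map_eq a).choose_spec, (C.exists_map_eq a').choose_spec,
      (C.exists_map_eq (a + a')).choose_spec, mul_add, add_mul]

theorem map_ρ (a : A) : C.φ (C.ρ a) = C.φ 1 * a * C.φ 1 := (C.exists_map_eq a).choose_spec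

theorem ρ_map (b : B) : C.ρ (C.φ b) = b := C.injective <| by
  rw [map_ρ, one_mul_map, map_mul_one]

/-- Compression to a corner is not multiplicative: the idempotent stays between the factors. -/
theorem ρ_mul_ρ (a a' : A) : C.ρ a * C.ρ a' = C.ρ (a * C.φ 1 * a') := C.injective <| by
  rw [map_mul, map_ρ, map_ρ, map_ρ]
  have h := C.one_mul_map 1
  calc C.φ 1 * a * C.φ 1 * (C.φ 1 * a' * C.φ 1)
      = C.φ 1 * a * (C.φ 1 * C.φ 1) * a' * C.φ 1 := by simp only [mul_assoc]
    _ = C.φ 1 * (a * C.φ 1 * a') * C.φ 1 := by rw [h]; simp only [mul_assoc]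

theorem ρ_one_mul (a : A) : C.ρ (C.φ 1 * a) = C.ρ a := by
  have := C.ρ_mul_ρ (C.φ 1) a
  rwa [ρ_map, one_mul, one_mul_map, eq_comm] at this

/-- Insert `∑ x_j y_j = 1` between `a` and `a'`; the idempotent in the middle is absorbed by `x_j`.
All the matrix identities for the induced module are instances of this one. -/
theorem sum_ρ_mul_ρ (a a' : A) : ∑ j, C.ρ (a * C.x j) * C.ρ (C.y j * a') = C.ρ (a * a') := by
  simp only [ρ_mul_ρ]
  rw [← map_sum]
  congr 1
  conv_rhs => rw [← C.sum_mul_x_mul_y a, Finset.sum_mul]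
  refine Finset.sum_congr rfl fun j _ => ?_
  rw [mul_assoc a, C.x_mul_one]
  simp only [mul_assoc]

end

variable [AddSubmonoidClass σ A] [AddSubmonoidClass τ B] [GradedRing 𝒜] [GradedRing ℬ]
  (C : FullCorner 𝒜 ℬ ι)

theorem ρ_mem {γ : Γ} {a : A} (h : a ∈ 𝒜 γ) : C.ρ a ∈ ℬ γ := by
  obtain ⟨b, hb, hba⟩ := C.exists_mem γ a h
  rwa [C.injective ((C.map_ρ a).trans hba.symm)]

/-! ### The functor `M ↦ M φ(1)` is fully faithful -/

/-- Since `m = ∑ (m x_j) y_j` with `m x_j ∈ M φ(1)`, a homomorphism is determined on the corner. -/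
theorem faithful : (cornerFunctor C.φ C.map_mem).Faithful where
  map_injective {M N f g} h := by
    ext m
    have key : ∀ j, f.hom (op (C.x j) • m) = g.hom (op (C.x j) • m) := fun j =>
      congrArg (fun q : (cornerFunctor C.φ C.map_mem).obj M ⟶ (cornerFunctor C.φ C.map_mem).obj N =>
        (q.hom (C.toCorner M j m) : corner C.φ N).1) h
    rw [← C.sum_smul_smul M m, map_sum, map_sum]
    refine Finset.sum_congr rfl fun j _ => ?_
    rw [f.hom.map_smul, g.hom.map_smul, key]

/-- The extension of a homomorphism `M φ(1) → N φ(1)` to a homomorphism `M → N`. -/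
def extend {M N : GrMod 𝒜}
    (g : (cornerFunctor C.φ C.map_mem).obj M ⟶ (cornerFunctor C.φ C.map_mem).obj N) : M ⟶ N :=
  let h : corner C.φ M →ₗ[Bᵐᵒᵖ] corner C.φ N := g.hom
  { hom :=
      { toFun := fun m => ∑ j, op (C.y j) • (h (C.toCorner M j m)).1
        map_add' := fun m n => by
          rw [← Finset.sum_add_distrib]
          refine Finset.sum_congr rfl fun j _ => ?_
          rw [← smul_add, ← AddSubgroup.coe_add, ← map_add, ← map_add]
        map_smul' := fun a m => by
          obtain ⟨a, rfl⟩ := op_surjective a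
          -- Here `m a x_l = ∑ (m x_j)(y_j a x_l)`, with coefficients in the corner, so the
          -- `B`-linearity of `g` applies.
          have key : ∀ l, C.toCorner M l (op a • m) =
              ∑ j, op (C.ρ (C.y j * a * C.x l)) •
                C.toCorner M j m := by
            intro l
            ext
            simp only [AddSubgroup.val_finsetSum, coe_op_smul_corner, coe_toCorner, map_ρ, smul_smul, ← op_mul]
            rw [← Finset.sum_smul, ← Finset.op_sum]
            congr 2
            have : ∀ j, C.x j * (C.φ 1 * (C.y j * a * C.x l) * C.φ 1) =
                C.x j * C.y j * (a * C.x l) := by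
              intro j
              rw [← mul_assoc (C.φ 1), ← mul_assoc (C.φ 1), C.one_mul_y]
              simp only [mul_assoc, C.x_mul_one]
            simp only [this]
            rw [← Finset.sum_mul, C.sum_x_mul_y, one_mul]
          simp only [key, map_sum, map_smul, AddSubgroup.val_finsetSum, coe_op_smul_corner, map_ρ,
            RingHom.id_apply, Finset.smul_sum, smul_smul, ← op_mul]
          -- With `j` outermost, the sum over `l` collapses by `∑ x_l y_l = 1` and leaves `y_j a`.
          rw [Finset.sum_comm]
          refine Finset.sum_congr rfl fun j _ => ?_
          have h₁ : ∀ l, C.φ 1 * (C.y j * a * C.x l) * C.φ 1 * C.y l =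
              C.y j * a * C.x l * C.y l := by
            intro l
            rw [mul_assoc _ (C.φ 1) (C.y l), C.one_mul_y, ← mul_assoc (C.φ 1), ← mul_assoc (C.φ 1),
              C.one_mul_y]
          simp only [h₁]
          rw [← Finset.sum_smul, ← Finset.op_sum, C.sum_mul_x_mul_y] }
    map_mem := fun {γ m} hm => by
      refine sum_mem fun j _ => ?_
      -- Multiplication by `x_j` raises the degree by `d_j`; multiplication by `y_j` lowers it
      -- again.
      have h₁ : op (C.x j) • m ∈ M.comp (γ + C.d j) := M.smul_mem hm (C.x_mem j)
      exact N.smul_mem_of_eq (g.map_mem (m := C.toCorner M j m)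
        h₁) (C.y_mem j) (add_neg_cancel_right γ _) }

theorem extend_hom_apply {M N : GrMod 𝒜}
    (g : (cornerFunctor C.φ C.map_mem).obj M ⟶ (cornerFunctor C.φ C.map_mem).obj N)
    (m : M.carrier) : (C.extend g).hom m =
      ∑ j, op (C.y j) •
        (g.hom (C.toCorner M j m) : corner C.φ N).1 := rfl

theorem full : (cornerFunctor C.φ C.map_mem).Full where
  map_surjective {M N} g := by
    refine ⟨C.extend g, ?_⟩
    let h : corner C.φ M →ₗ[Bᵐᵒᵖ] corner C.φ N := g.hom
    ext m
    change corner C.φ M at m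
    refine Subtype.ext ?_
    refine (C.extend_hom_apply g m.1).trans ?_
    change ∑ j, op (C.y j) • (h (C.toCorner M j m.1)).1 = (h m).1
    -- On the corner, `m x_j` is the action of the element `ρ (x_j)` of `B`, so `g` commutes with
    -- it.
    have key : ∀ j, (C.toCorner M j m.1) =
        op (C.ρ (C.x j)) • m := by
      intro j
      ext
      rw [coe_op_smul_corner, map_ρ, mul_assoc, C.x_mul_one, op_mul, mul_smul, mem_corner.1 m.2,
        coe_toCorner]
    have key' : ∀ j, op (C.y j) • op (C.φ (C.ρ (C.x j))) • (h m).1 =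
        op (C.y j) • op (C.x j) • (h m).1 := by
      intro j
      rw [map_ρ, mul_assoc, C.x_mul_one, op_mul, mul_smul, mem_corner.1 (h m).2]
    simp only [key, map_smul, coe_op_smul_corner, key']
    exact C.sum_smul_smul N _

/-! ### The functor `M ↦ M φ(1)` is essentially surjective -/

/-- The action of `a ∈ A` on `N^ι` by the matrix with entries `y_j a x_l`. -/
def act (N : GrMod ℬ) (a : A) : (ι → N.carrier) →+ (ι → N.carrier) where
  toFun n l := ∑ j, op (C.ρ (C.y j * a * C.x l)) • n j
  map_zero' := by
    ext l
    simp
  map_add' m n := by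
    ext l
    simp [Finset.sum_add_distrib]

variable (N : GrMod ℬ)

theorem act_apply (a : A) (n : ι → N.carrier) (l : ι) :
    C.act N a n l = ∑ j, op (C.ρ (C.y j * a * C.x l)) • n j := rfl

theorem act_add (a a' : A) (n : ι → N.carrier) :
    C.act N (a + a') n = C.act N a n + C.act N a' n := by
  ext l
  simp only [act_apply, Pi.add_apply, mul_add, add_mul, map_add, MulOpposite.op_add, add_smul,
    Finset.sum_add_distrib]

theorem act_zero (n : ι → N.carrier) : C.act N 0 n = 0 := by
  ext l
  simp [act_apply]

/-- The matrices `(ρ (y_j a x_l))` multiply like the elements `a`. The matrix of `1` is only an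
idempotent, so a unital module arises on its fixed subgroup. -/
theorem act_act (a a' : A) (n : ι → N.carrier) :
    C.act N a' (C.act N a n) = C.act N (a * a') n := by
  ext l
  simp only [act_apply, Finset.smul_sum, smul_smul, ← op_mul]
  rw [Finset.sum_comm]
  refine Finset.sum_congr rfl fun j _ => ?_
  rw [← Finset.sum_smul, ← Finset.op_sum]
  congr 2
  have := C.sum_ρ_mul_ρ (C.y j * a) (a' * C.x l)
  simpa only [mul_assoc] using this

/-- The subgroup of `N^ι` fixed by the idempotent matrix with entries `y_j x_l`. -/
def inducedSubgroup : AddSubgroup (ι → N.carrier) where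
  carrier := {n | C.act N 1 n = n}
  zero_mem' := map_zero _
  add_mem' {m n} hm hn := by
    rw [Set.mem_ofPred_eq] at *
    rw [map_add, hm, hn]
  neg_mem' {m} hm := by
    rw [Set.mem_ofPred_eq] at *
    rw [map_neg, hm]

theorem act_mem (a : A) (n : ι → N.carrier) : C.act N a n ∈ C.inducedSubgroup N := by
  change C.act N 1 (C.act N a n) = C.act N a n
  rw [act_act, mul_one]

instance : Module Aᵐᵒᵖ (C.inducedSubgroup N) where
  smul a n := ⟨C.act N a.unop n.1, C.act_mem N _ _⟩
  one_smul n := Subtype.ext n.2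
  mul_smul a a' n := Subtype.ext (C.act_act N a'.unop a.unop n.1).symm
  smul_zero _ := Subtype.ext (map_zero _)
  smul_add _ _ _ := Subtype.ext (map_add _ _ _)
  add_smul a a' n := Subtype.ext (C.act_add N a.unop a'.unop n.1)
  zero_smul n := Subtype.ext (C.act_zero N n.1)

/-- The graded right `A`-module induced by a graded right `B`-module. -/
def induced : GrMod 𝒜 where
  carrier := C.inducedSubgroup N
  comp γ :=
    { carrier := {n | ∀ j, n.1 j ∈ N.comp (C.d j + γ)}
      zero_mem' := fun j => zero_mem _
      add_mem' := fun hm hn j => add_mem (hm j) (hn j)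
      neg_mem' := fun hm j => neg_mem (hm j) }
  isInternal := by
    classical
    -- The fixed subgroup is a retract of the sum of the shifts `N(d_j)`: project to the
    -- coordinates, and return by the idempotent matrix, whose `(j, l)` entry has degree `d_l -
    -- d_j`.
    refine isInternal_of_retract _ (fun j => (N.shift (C.d j)).comp)
      (fun j => (N.shift (C.d j)).isInternal)
      (fun j => (Pi.evalAddMonoidHom (fun _ => N.carrier) j).comp (C.inducedSubgroup N).subtype)
      (fun j => ((C.act N 1).comp (AddMonoidHom.single (fun _ => N.carrier) j)).codRestrict _
        fun n => C.act_mem N _ _) (fun j γ n hn => hn j) ?_ ?_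
    · intro j γ (n : N.carrier) hn l
      change C.act N 1 (Pi.single j n) l ∈ N.comp (C.d l + γ)
      rw [act_apply, Finset.sum_eq_single j, mul_one]
      · rw [Pi.single_eq_same]
        refine N.smul_mem_of_eq (γ := C.d j + γ) hn
          (C.ρ_mem (SetLike.mul_mem_graded (C.y_mem j) (C.x_mem l))) ?_
        abel
      · intro j' _ h
        rw [Pi.single_eq_of_ne h, smul_zero]
      · simp
    · intro n
      ext1
      rw [AddSubgroup.val_finsetSum]
      change ∑ j, C.act N 1 (Pi.single j (n.1 j)) = n.1
      rw [← map_sum, Finset.univ_sum_single]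
      exact n.2
  smul_mem {γ δ n a} hn ha l := by
    change C.act N a (n : C.inducedSubgroup N).1 l ∈ _
    rw [act_apply]
    refine sum_mem fun j _ => N.smul_mem_of_eq (hn j)
      (C.ρ_mem (SetLike.mul_mem_graded (SetLike.mul_mem_graded (C.y_mem j) ha) (C.x_mem l))) ?_
    abel

/-- The tuples `(n ρ (x_l))_l` are the candidates for the corner of the induced module. Taking `a =
1` puts them in the induced module, `a = φ 1` in its corner, and `a = φ b` gives `B`-linearity. -/
theorem act_col (a : A) (n : N.carrier) :
    C.act N a (fun l => op (C.ρ (C.x l)) • n) = fun l => op (C.ρ (a * C.x l)) • n := by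
  ext l
  simp only [act_apply, smul_smul, ← op_mul]
  rw [← Finset.sum_smul, ← Finset.op_sum]
  congr 2
  have := C.sum_ρ_mul_ρ 1 (a * C.x l)
  simpa only [one_mul, mul_assoc] using this

theorem ρ_map_mul (b : B) (a : A) : C.ρ (C.φ b * a) = b * C.ρ a := by
  have := C.ρ_mul_ρ (C.φ b) a
  rw [ρ_map, map_mul_one] at this
  exact this.symm

/-- The isomorphism of `N` with `M φ(1)` for the module `M` induced by `N`. -/
def unitEquiv : N.carrier ≃ₗ[Bᵐᵒᵖ] corner C.φ (C.induced N) where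
  toFun n := ⟨(⟨fun l => op (C.ρ (C.x l)) • n, by
      change C.act N 1 _ = _
      rw [act_col]
      simp only [one_mul]⟩ : C.inducedSubgroup N), Subtype.ext <| by
      change C.act N (C.φ 1) _ = _
      rw [act_col]
      simp only [ρ_one_mul]⟩
  map_add' m n := Subtype.ext <| Subtype.ext <| funext fun l => smul_add _ _ _
  map_smul' b n := Subtype.ext <| Subtype.ext <| by
    refine Eq.trans ?_ (C.act_col N (C.φ b.unop) n).symm
    ext l
    rw [ρ_map_mul, op_mul, mul_smul]
    rfl
  invFun m := ∑ j, op (C.ρ (C.y j)) • (m.1 : C.inducedSubgroup N).1 j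
  left_inv n := by
    simp only [smul_smul, ← op_mul]
    rw [← Finset.sum_smul, ← Finset.op_sum]
    have h := C.sum_ρ_mul_ρ 1 1
    simp only [one_mul, mul_one] at h
    have h' : C.ρ 1 = 1 := by
      rw [← C.ρ_one_mul, mul_one, ρ_map]
    rw [h, h', op_one, one_smul]
  right_inv m := by
    refine Subtype.ext (Subtype.ext ?_)
    -- Going back and forth gives `n_j ↦ ∑ n_j ρ (y_j φ(1) x_l)`, which is the action of `φ 1`,
    -- trivial on the corner.
    have h : C.act N (C.φ 1) (m.1 : C.inducedSubgroup N).1 = (m.1 : C.inducedSubgroup N).1 :=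
      congrArg Subtype.val m.2
    conv_rhs => rw [← h]
    ext l
    rw [act_apply]
    simp only [Finset.smul_sum, smul_smul, ← op_mul, ρ_mul_ρ]

theorem essSurj : (cornerFunctor C.φ C.map_mem).EssSurj where
  mem_essImage N := by
    refine ⟨C.induced N, ⟨?_⟩⟩
    exact
      { hom := ⟨(C.unitEquiv N).symm.toLinearMap, fun {γ m} hm =>
          sum_mem fun j _ => N.smul_mem_of_eq (hm j) (C.ρ_mem (C.y_mem j)) (by abel)⟩
        inv := ⟨(C.unitEquiv N).toLinearMap, fun {γ n} hn l =>
          N.smul_mem_of_eq hn (C.ρ_mem (C.x_mem l)) (add_comm _ _)⟩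
        hom_inv_id := by
          ext m
          exact (C.unitEquiv N).apply_symm_apply m
        inv_hom_id := by
          ext n
          exact (C.unitEquiv N).symm_apply_apply n }

/-- A graded ring is graded Morita equivalent to a full corner. -/
theorem gradedMoritaEquivalent (C : FullCorner 𝒜 ℬ ι) : GradedMoritaEquivalent 𝒜 ℬ :=
  ⟨cornerFunctor C.φ C.map_mem,
    { faithful := C.faithful, full := C.full, essSurj := C.essSurj }, ⟨inferInstance⟩⟩

end FullCorner

end GrMod

namespace KGraph

variable {k : ℕ}

/-! ### Composition of paths -/

section Composition

variable {Λ : KGraph.{u} k}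

/-- The path `c` is the composite `a b`. -/
def IsComp (a b c : Λ.Path) : Prop :=
  ∃ h : b.range = a.source, c = Λ.path (b.hom ≫ eqToHom h ≫ a.hom)

theorem isComp_path {a b c : Λ.Obj} (g : a ⟶ b) (f : b ⟶ c) :
    IsComp (Λ.path f) (Λ.path g) (Λ.path (g ≫ f)) :=
  ⟨rfl, by
    change Λ.path (g ≫ f) = Λ.path (g ≫ 𝟙 b ≫ f)
    rw [Category.id_comp]⟩

/-- Turns the propositional equality of the middle vertices into honest composability, so that
statements about morphisms apply. -/
theorem IsComp.exists_eq {a b c : Λ.Path} (h : IsComp a b c) :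
    ∃ (x y z : Λ.Obj) (g : x ⟶ y) (f : y ⟶ z), a = Λ.path f ∧ b = Λ.path g ∧
      c = Λ.path (g ≫ f) := by
  obtain ⟨a₁, a₂, f⟩ := a
  obtain ⟨b₁, b₂, g⟩ := b
  obtain ⟨h, rfl⟩ := h
  dsimp only at h
  subst h
  exact ⟨_, _, _, g, f, rfl, rfl, by simp⟩

theorem exists_isComp {a b : Λ.Path} (h : a.source = b.range) : ∃ c, IsComp a b c :=
  ⟨_, h.symm, rfl⟩

namespace IsComp

variable {a b c a' b' c' d e : Λ.Path}

theorem unique (h : IsComp a b c) (h' : IsComp a b c') : c = c' := by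
  obtain ⟨_, rfl⟩ := h
  obtain ⟨_, rfl⟩ := h'
  rfl

theorem source_eq_range (h : IsComp a b c) : a.source = b.range := h.1.symm

theorem source_eq (h : IsComp a b c) : c.source = b.source := by
  obtain ⟨_, rfl⟩ := h
  rfl

theorem range_eq (h : IsComp a b c) : c.range = a.range := by
  obtain ⟨_, rfl⟩ := h
  rfl

theorem deg_eq (h : IsComp a b c) : c.deg = a.deg + b.deg := by
  obtain ⟨_, _, _, _, _, rfl, rfl, rfl⟩ := h.exists_eq
  exact Λ.degree_comp _ _

theorem assoc (h : IsComp a b d) (h' : IsComp d c e) : ∃ f, IsComp b c f ∧ IsComp a f e := by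
  obtain ⟨f, hf⟩ := exists_isComp (h.source_eq.symm.trans h'.source_eq_range)
  refine ⟨f, hf, ?_⟩
  obtain ⟨a₁, a₂, a⟩ := a
  obtain ⟨b₁, b₂, b⟩ := b
  obtain ⟨c₁, c₂, c⟩ := c
  obtain ⟨h₁, rfl⟩ := h
  obtain ⟨h₂, rfl⟩ := hf
  obtain ⟨_, rfl⟩ := h'
  dsimp only at h₁ h₂
  subst h₁ h₂
  refine ⟨rfl, ?_⟩
  change Λ.path (c ≫ 𝟙 _ ≫ b ≫ 𝟙 _ ≫ a) = Λ.path ((c ≫ 𝟙 _ ≫ b) ≫ 𝟙 _ ≫ a)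
  simp

theorem assoc' (h : IsComp b c d) (h' : IsComp a d e) : ∃ f, IsComp a b f ∧ IsComp f c e := by
  obtain ⟨f, hf⟩ := exists_isComp (h'.source_eq_range.trans h.range_eq)
  obtain ⟨e', he'⟩ := exists_isComp (hf.source_eq.trans h.source_eq_range)
  obtain ⟨d', hd', h''⟩ := hf.assoc he'
  obtain rfl := h.unique hd'
  obtain rfl := h'.unique h''
  exact ⟨f, hf, he'⟩

/-- Degrees cancel in `ℕ^k`, so the second factors also have equal degrees and unique factorization
applies. -/
theorem cancel (h : IsComp a b c) (h' : IsComp a' b' c) (hd : a.deg = a'.deg) :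
    a = a' ∧ b = b' := by
  have hd' : b.deg = b'.deg := by
    have := h.deg_eq.symm.trans h'.deg_eq
    rwa [hd, add_right_inj] at this
  obtain ⟨x, y, z, g, f, rfl, rfl, rfl⟩ := h.exists_eq
  obtain ⟨x', y', z', g', f', rfl, rfl, hc⟩ := h'.exists_eq
  obtain ⟨rfl, hc⟩ := Path.mk.inj hc
  obtain ⟨rfl, hc⟩ := hc
  have hc := eq_of_heq hc
  have := (Λ.factorization (g ≫ f) _ _ (Λ.degree_comp g f)).unique
    (y₁ := ⟨y, f, g⟩) (y₂ := ⟨y', f', g'⟩) ⟨rfl, rfl, rfl⟩ ⟨hd.symm, hd'.symm, hc.symm⟩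
  simp only [Sigma.mk.injEq] at this
  obtain ⟨rfl, this⟩ := this
  cases this
  exact ⟨rfl, rfl⟩

end IsComp

theorem exists_isComp_of_deg_eq (c : Λ.Path) (n m : Fin k → ℕ) (h : c.deg = n + m) :
    ∃ a b, IsComp a b c ∧ a.deg = n ∧ b.deg = m := by
  obtain ⟨c₁, c₂, f⟩ := c
  obtain ⟨⟨c, f₁, f₂⟩, ⟨h₁, h₂, h₃⟩, -⟩ := Λ.factorization f n m h
  dsimp only at h₁ h₂ h₃
  subst h₃
  exact ⟨Λ.path f₁, Λ.path f₂, isComp_path _ _, h₁, h₂⟩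

theorem isComp_idPath_left (a : Λ.Path) : IsComp (Λ.idPath a.range) a a :=
  ⟨rfl, by simp [path, idPath]⟩

theorem isComp_idPath_right (a : Λ.Path) : IsComp a (Λ.idPath a.source) a :=
  ⟨rfl, by simp [path, idPath]⟩

section Family

variable {B : Type*} [NonUnitalRing B] {p : Λ.Obj → B} {s t : Λ.Path → B} {a b c : Λ.Path}

theorem IsKPFamily.real_mul_real (H : Λ.IsKPFamily p s t) (h : IsComp a b c) :
    s a * s b = s c := by
  obtain ⟨_, _, _, _, _, rfl, rfl, rfl⟩ := h.exists_eq
  exact H.real_comp _ _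

theorem IsKPFamily.ghost_mul_ghost (H : Λ.IsKPFamily p s t) (h : IsComp a b c) :
    t b * t a = t c := by
  obtain ⟨_, _, _, _, _, rfl, rfl, rfl⟩ := h.exists_eq
  exact H.ghost_comp _ _

end Family

/-- The paths of degree `n`. -/
abbrev PathOfDeg (Λ : KGraph.{u} k) (n : Fin k → ℕ) : Type u := {a : Λ.Path // a.deg = n}

instance [h : Λ.RowFiniteNoSources] [Finite Λ.Obj] (n : Fin k → ℕ) : Finite (Λ.PathOfDeg n) := by
  have : {a : Λ.Path | a.deg = n} = ⋃ v, {a : Λ.Path | a.range = v ∧ a.deg = n} := by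
    ext a
    simp
  have h' : {a : Λ.Path | a.deg = n}.Finite := by
    rw [this]
    exact Set.finite_iUnion fun v => h.finite v n
  exact h'.to_subtype

instance [Λ.RowFiniteNoSources] [Finite Λ.Obj] (n : Fin k → ℕ) : Fintype (Λ.PathOfDeg n) :=
  Fintype.ofFinite _

/-- Group the paths by their range and apply the fourth Kumjian-Pask relation at each vertex. -/
theorem KP.sum_real_mul_ghost (𝕜 : Type w) [Field 𝕜] [h : Λ.RowFiniteNoSources] [Finite Λ.Obj]
    (n : Fin k → ℕ) : ∑ a : Λ.PathOfDeg n, s 𝕜 a.1 * t 𝕜 a.1 = 1 := by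
  classical
  let := Fintype.ofFinite Λ.Obj
  rw [one_eq_unit, unit, ← Finset.sum_fiberwise _ (fun a : Λ.PathOfDeg n => a.1.range)]
  refine Finset.sum_congr rfl fun v _ => ?_
  rw [isKPFamily.vert_eq_sum v n ((Finset.univ.filter fun a : Λ.PathOfDeg n => a.1.range = v).map
    (Function.Embedding.subtype _)), Finset.sum_map]
  · rfl
  · intro a
    simp

end Composition

/-! ### The homomorphism from the algebra of the sink deletion -/

section Incl

variable {Λ : KGraph.{u} k} {v : Λ.Obj}

/-- A surviving vertex as a vertex of the sink deletion. -/
def sinkDeletionVert {u : Λ.Obj} (h : Λ.Survives v u) : (Λ.sinkDeletion v).Obj := ⟨u, h⟩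

theorem IsComp.incl {a b c : (Λ.sinkDeletion v).Path} (h : IsComp a b c) :
    IsComp (Λ.sinkDeletionIncl v a) (Λ.sinkDeletionIncl v b) (Λ.sinkDeletionIncl v c) := by
  obtain ⟨_, _, _, g, f, rfl, rfl, rfl⟩ := h.exists_eq
  exact isComp_path (Λ := Λ) _ _

theorem exists_incl_eq {a : Λ.Path} (h : Λ.Survives v a.range) :
    ∃ b, Λ.sinkDeletionIncl v b = a :=
  ⟨⟨⟨a.source, h.of_hom a.hom⟩, ⟨a.range, h⟩, a.hom⟩, rfl⟩

theorem deg_incl (a : (Λ.sinkDeletion v).Path) : (Λ.sinkDeletionIncl v a).deg = a.deg := rfl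

theorem IsComp.of_incl {a b c : (Λ.sinkDeletion v).Path}
    (h : IsComp (Λ.sinkDeletionIncl v a) (Λ.sinkDeletionIncl v b) (Λ.sinkDeletionIncl v c)) :
    IsComp a b c := by
  obtain ⟨c', hc'⟩ := exists_isComp (Subtype.ext h.source_eq_range : a.source = b.range)
  rwa [Λ.sinkDeletionIncl_injective v (h.unique hc'.incl)]

variable {B : Type*} [NonUnitalRing B] {p : Λ.Obj → B} {s t : Λ.Path → B}

/-- The only relation that could fail on restriction is the fourth; it survives because every path
of `Λ` into a surviving vertex belongs to the sink deletion, so the sums are the same. -/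
theorem IsKPFamily.sinkDeletion (H : Λ.IsKPFamily p s t) :
    (Λ.sinkDeletion v).IsKPFamily (fun w => p w.1) (fun a => s (Λ.sinkDeletionIncl v a))
      (fun a => t (Λ.sinkDeletionIncl v a)) := by
  intro y z h
  cases h with
  | real_id w => exact H _ _ (.real_id w.1)
  | ghost_id w => exact H _ _ (.ghost_id w.1)
  | kp1_same w => exact H.vert_mul_same w.1
  | kp1_ne h => exact H.vert_mul_ne fun h' => h (Subtype.ext h')
  | kp2_real g f => exact H.real_mul_real (isComp_path g f).incl
  | kp2_ghost g f => exact H.ghost_mul_ghost (isComp_path g f).incl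
  | kp2_vert_real a => exact H.vert_real (Λ.sinkDeletionIncl v a)
  | kp2_real_vert a => exact H.real_vert (Λ.sinkDeletionIncl v a)
  | kp2_vert_ghost a => exact H.vert_ghost (Λ.sinkDeletionIncl v a)
  | kp2_ghost_vert a => exact H.ghost_vert (Λ.sinkDeletionIncl v a)
  | kp3_same a => exact H.ghost_real_same _
  | kp3_ne ha hd h =>
    exact H.ghost_real_ne hd fun h' => h (Λ.sinkDeletionIncl_injective v h')
  | kp4 w n hn F hF =>
    have := H.vert_eq_sum w.1 n (F.map ⟨_, Λ.sinkDeletionIncl_injective v⟩) ?_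
    · rwa [Finset.sum_map] at this
    intro a
    rw [Finset.mem_map]
    constructor
    · rintro ⟨b, hb, rfl⟩
      obtain ⟨h₁, h₂⟩ := (hF b).1 hb
      exact ⟨congrArg Subtype.val h₁, h₂⟩
    · rintro ⟨h₁, h₂⟩
      obtain ⟨b, rfl⟩ := exists_incl_eq (v := v) (a := a) (h₁ ▸ w.2)
      exact ⟨b, (hF b).2 ⟨Subtype.ext h₁, h₂⟩, rfl⟩

end Incl

/-! ### A family of matrices over the algebra of the sink deletion -/

section MatrixFamily

variable {Λ : KGraph.{u} k} {v : Λ.Obj} {n : Fin k → ℕ}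

/-- The commuting squares `a l = l' b` with `l` and `l'` of degree `n` and `b` in the sink
deletion. -/
def IsSquare (v : Λ.Obj) (a : Λ.Path) (l l' : Λ.PathOfDeg n) (b : (Λ.sinkDeletion v).Path) : Prop :=
  ∃ c, IsComp a l.1 c ∧ IsComp l'.1 (Λ.sinkDeletionIncl v b) c

/-- Refactor `a l` with its first factor of degree `n`. The second factor then ends at the source of
a path of degree `n`, which survives. -/
theorem exists_isSquare (hn : ∀ a : Λ.Path, a.deg = n → Λ.Survives v a.source) {a : Λ.Path}
    {l : Λ.PathOfDeg n} (h : a.source = l.1.range) : ∃ l' b, IsSquare v a l l' b := by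
  obtain ⟨c, hc⟩ := exists_isComp h
  obtain ⟨l', b, hb, hl', -⟩ := exists_isComp_of_deg_eq c n a.deg (by rw [hc.deg_eq, l.2, add_comm])
  obtain ⟨b, rfl⟩ := exists_incl_eq (v := v) (a := b) (hb.source_eq_range ▸ hn l' hl')
  exact ⟨⟨l', hl'⟩, b, c, hc, hb⟩

theorem exists_isSquare' {l' : Λ.PathOfDeg n} {b : (Λ.sinkDeletion v).Path}
    (h : l'.1.source = b.range.1) : ∃ a l, IsSquare v a l l' b := by
  obtain ⟨c, hc⟩ := exists_isComp (b := Λ.sinkDeletionIncl v b) h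
  obtain ⟨a, l, hb, -, hl⟩ := exists_isComp_of_deg_eq c b.deg n
    (by rw [hc.deg_eq, l'.2, deg_incl, add_comm])
  exact ⟨a, ⟨l, hl⟩, c, hb, hc⟩

/-! ### Uniqueness and pasting of squares -/

namespace IsSquare

variable {a a' : Λ.Path} {l l' m m' : Λ.PathOfDeg n} {b b' : (Λ.sinkDeletion v).Path}

theorem unique (h : IsSquare v a l l' b) (h' : IsSquare v a l m' b') : l' = m' ∧ b = b' := by
  obtain ⟨c, h₁, h₂⟩ := h
  obtain ⟨c', h₁', h₂'⟩ := h'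
  obtain rfl := h₁.unique h₁'
  obtain ⟨h, h'⟩ := h₂.cancel h₂' (l'.2.trans m'.2.symm)
  exact ⟨Subtype.ext h, Λ.sinkDeletionIncl_injective v h'⟩

theorem deg_eq (h : IsSquare v a l l' b) : a.deg = b.deg := by
  obtain ⟨c, h₁, h₂⟩ := h
  have := h₁.deg_eq.symm.trans h₂.deg_eq
  rwa [l.2, l'.2, add_comm, add_right_inj] at this

/-- A square is also determined by its other two sides: the composite `l' b` is known, and so is the
degree of `a`. -/
theorem unique' (h : IsSquare v a l l' b) (h' : IsSquare v a' m l' b) : a = a' ∧ l = m := by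
  have hd := h.deg_eq.trans h'.deg_eq.symm
  obtain ⟨c, h₁, h₂⟩ := h
  obtain ⟨c', h₁', h₂'⟩ := h'
  obtain rfl := h₂.unique h₂'
  obtain ⟨h, h'⟩ := h₁.cancel h₁' hd
  exact ⟨h, Subtype.ext h'⟩

theorem source_eq_range (h : IsSquare v a l l' b) : a.source = l.1.range :=
  h.choose_spec.1.source_eq_range

theorem range_eq (h : IsSquare v a l l' b) : a.range = l'.1.range :=
  h.choose_spec.1.range_eq.symm.trans h.choose_spec.2.range_eq

theorem source_eq_range' (h : IsSquare v a l l' b) : l'.1.source = b.range.1 :=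
  h.choose_spec.2.source_eq_range

theorem source_eq (h : IsSquare v a l l' b) : l.1.source = b.source.1 :=
  h.choose_spec.1.source_eq.symm.trans h.choose_spec.2.source_eq

/-- Pasting: `a a' l = a m b' = m' b b'`. -/
theorem comp {c : Λ.Path} (h' : IsSquare v a' l m b') (h : IsSquare v a m m' b)
    (hc : IsComp a a' c) : ∃ d, IsComp b b' d ∧ IsSquare v c l m' d := by
  obtain ⟨x', h₁', h₂'⟩ := h'
  obtain ⟨x, h₁, h₂⟩ := h
  obtain ⟨e, he⟩ := exists_isComp (hc.source_eq_range.trans h₁'.range_eq.symm)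
  obtain ⟨c', hc', h₃⟩ := h₁'.assoc' he
  obtain rfl := hc.unique hc'
  obtain ⟨y, hy, h₄⟩ := h₂'.assoc' he
  obtain rfl := h₁.unique hy
  obtain ⟨d, hd, h₅⟩ := h₂.assoc h₄
  obtain ⟨d, rfl⟩ := exists_incl_eq (v := v) (a := d) (hd.range_eq ▸ b.range.2)
  exact ⟨d, hd.of_incl, e, h₃, h₅⟩

end IsSquare

theorem isSquare_id (hn : ∀ a : Λ.Path, a.deg = n → Λ.Survives v a.source) (l : Λ.PathOfDeg n) :
    IsSquare v (Λ.idPath l.1.range) l l ((Λ.sinkDeletion v).idPath (sinkDeletionVert (hn l.1 l.2))) :=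
  ⟨l.1, isComp_idPath_left _, isComp_idPath_right _⟩

/-! ### The matrices of a path and their Kumjian-Pask relations -/

variable (𝕜 : Type w) [Field 𝕜]

open scoped Classical in
/-- The matrix `∑ E_{l',l} s_b` over the squares `a l = l' b`. -/
def realMatrix (v : Λ.Obj) (n : Fin k → ℕ) (a : Λ.Path) :
    Matrix (Λ.PathOfDeg n) (Λ.PathOfDeg n) ((Λ.sinkDeletion v).KP 𝕜) :=
  fun l' l => if h : ∃ b, IsSquare v a l l' b then KP.s 𝕜 h.choose else 0

open scoped Classical in
/-- The matrix `∑ E_{l,l'} s_{b^*}` over the squares `a l = l' b`. -/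
def ghostMatrix (v : Λ.Obj) (n : Fin k → ℕ) (a : Λ.Path) :
    Matrix (Λ.PathOfDeg n) (Λ.PathOfDeg n) ((Λ.sinkDeletion v).KP 𝕜) :=
  fun l l' => if h : ∃ b, IsSquare v a l l' b then KP.t 𝕜 h.choose else 0

variable {𝕜} {a a' c : Λ.Path} {l l' m : Λ.PathOfDeg n} {b b' : (Λ.sinkDeletion v).Path}

theorem realMatrix_apply (h : IsSquare v a l l' b) : realMatrix 𝕜 v n a l' l = KP.s 𝕜 b := by
  have h' : ∃ b, IsSquare v a l l' b := ⟨b, h⟩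
  rw [realMatrix, dif_pos h', (h.unique h'.choose_spec).2]

theorem ghostMatrix_apply (h : IsSquare v a l l' b) : ghostMatrix 𝕜 v n a l l' = KP.t 𝕜 b := by
  have h' : ∃ b, IsSquare v a l l' b := ⟨b, h⟩
  rw [ghostMatrix, dif_pos h', (h.unique h'.choose_spec).2]

theorem realMatrix_apply_eq_zero (h : ∀ b, ¬ IsSquare v a l l' b) :
    realMatrix 𝕜 v n a l' l = 0 :=
  dif_neg fun ⟨b, hb⟩ => h b hb

theorem ghostMatrix_apply_eq_zero (h : ∀ b, ¬ IsSquare v a l l' b) :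
    ghostMatrix 𝕜 v n a l l' = 0 :=
  dif_neg fun ⟨b, hb⟩ => h b hb

variable [Λ.RowFiniteNoSources] [Finite Λ.Obj]
  {M : Matrix (Λ.PathOfDeg n) (Λ.PathOfDeg n) ((Λ.sinkDeletion v).KP 𝕜)}

/-- Each column of the matrix of `a` has at most one nonzero entry, because `a` and `l` determine
the square. -/
theorem mul_realMatrix_apply (h : IsSquare v a l l' b) :
    (M * realMatrix 𝕜 v n a) m l = M m l' * KP.s 𝕜 b := by
  rw [Matrix.mul_apply, Finset.sum_eq_single l', realMatrix_apply h]
  · intro x _ hx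
    rw [realMatrix_apply_eq_zero fun _ hb => hx (hb.unique h).1, mul_zero]
  · simp

theorem ghostMatrix_mul_apply (h : IsSquare v a l l' b) :
    (ghostMatrix 𝕜 v n a * M) l m = KP.t 𝕜 b * M l' m := by
  rw [Matrix.mul_apply, Finset.sum_eq_single l', ghostMatrix_apply h]
  · intro x _ hx
    rw [ghostMatrix_apply_eq_zero fun _ hb => hx (hb.unique h).1, zero_mul]
  · simp

theorem mul_realMatrix_apply_eq_zero (h : a.source ≠ l.1.range) :
    (M * realMatrix 𝕜 v n a) m l = 0 := by
  rw [Matrix.mul_apply]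
  refine Finset.sum_eq_zero fun x _ => ?_
  rw [realMatrix_apply_eq_zero fun _ hb => h hb.source_eq_range, mul_zero]

theorem ghostMatrix_mul_apply_eq_zero (h : a.source ≠ l.1.range) :
    (ghostMatrix 𝕜 v n a * M) l m = 0 := by
  rw [Matrix.mul_apply]
  refine Finset.sum_eq_zero fun x _ => ?_
  rw [ghostMatrix_apply_eq_zero fun _ hb => h hb.source_eq_range, zero_mul]

variable (hn : ∀ a : Λ.Path, a.deg = n → Λ.Survives v a.source)
include hn

theorem realMatrix_mul_realMatrix (h : IsComp a a' c) :
    realMatrix 𝕜 v n a * realMatrix 𝕜 v n a' = realMatrix 𝕜 v n c := by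
  ext m' l
  by_cases hl : a'.source = l.1.range
  · obtain ⟨m, b', hm⟩ := exists_isSquare hn hl
    rw [mul_realMatrix_apply hm]
    obtain ⟨m'', b, hm'⟩ := exists_isSquare hn (h.source_eq_range.trans hm.range_eq)
    obtain ⟨d, hd, hs⟩ := hm.comp hm' h
    by_cases he : m' = m''
    · subst he
      rw [realMatrix_apply hm', realMatrix_apply hs, KP.isKPFamily.real_mul_real hd]
    · rw [realMatrix_apply_eq_zero fun _ hb => he (hb.unique hm').1,
        realMatrix_apply_eq_zero fun _ hb => he (hb.unique hs).1, zero_mul]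
  · rw [mul_realMatrix_apply_eq_zero hl,
      realMatrix_apply_eq_zero fun _ hb => hl (h.source_eq.symm.trans hb.source_eq_range)]

theorem ghostMatrix_mul_ghostMatrix (h : IsComp a a' c) :
    ghostMatrix 𝕜 v n a' * ghostMatrix 𝕜 v n a = ghostMatrix 𝕜 v n c := by
  ext l m'
  by_cases hl : a'.source = l.1.range
  · obtain ⟨m, b', hm⟩ := exists_isSquare hn hl
    rw [ghostMatrix_mul_apply hm]
    obtain ⟨m'', b, hm'⟩ := exists_isSquare hn (h.source_eq_range.trans hm.range_eq)
    obtain ⟨d, hd, hs⟩ := hm.comp hm' h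
    by_cases he : m' = m''
    · subst he
      rw [ghostMatrix_apply hm', ghostMatrix_apply hs, KP.isKPFamily.ghost_mul_ghost hd]
    · rw [ghostMatrix_apply_eq_zero fun _ hb => he (hb.unique hm').1,
        ghostMatrix_apply_eq_zero fun _ hb => he (hb.unique hs).1, mul_zero]
  · rw [ghostMatrix_mul_apply_eq_zero hl,
      ghostMatrix_apply_eq_zero fun _ hb => hl (h.source_eq.symm.trans hb.source_eq_range)]

/-- The matrix of a vertex `u` is diagonal, with entry `p_{s(l)}` when `r(l) = u` and `0` otherwise.
-/
theorem realMatrix_idPath_apply (l : Λ.PathOfDeg n) :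
    realMatrix 𝕜 v n (Λ.idPath l.1.range) l l =
      KP.p 𝕜 (sinkDeletionVert (hn l.1 l.2)) := by
  rw [realMatrix_apply (isSquare_id hn l), KP.s_idPath]

theorem realMatrix_idPath_apply_eq_zero {u : Λ.Obj} (h : l' = l → l.1.range ≠ u) :
    realMatrix 𝕜 v n (Λ.idPath u) l' l = 0 := by
  refine realMatrix_apply_eq_zero fun b hb => ?_
  obtain rfl : u = l.1.range := hb.source_eq_range
  exact h (hb.unique (isSquare_id hn l)).1 rfl

theorem ghostMatrix_idPath (u : Λ.Obj) :
    ghostMatrix 𝕜 v n (Λ.idPath u) = realMatrix 𝕜 v n (Λ.idPath u) := by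
  ext l l'
  by_cases h : l = l' ∧ l.1.range = u
  · obtain ⟨rfl, rfl⟩ := h
    rw [realMatrix_idPath_apply hn, ghostMatrix_apply (isSquare_id hn l), KP.t_idPath]
  · rw [realMatrix_idPath_apply_eq_zero hn fun h₁ h₂ => h ⟨h₁, h₁ ▸ h₂⟩]
    refine ghostMatrix_apply_eq_zero fun b hb => h ?_
    obtain rfl : u = l.1.range := hb.source_eq_range
    exact ⟨(hb.unique (isSquare_id hn l)).1.symm, rfl⟩

/-- The `(l, m)` entry is `s_{b^*} s_d` for squares `a l = l' b` and `a m = l' d`. Here `b` and `d`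
have the degree of `a`, and `b = d` forces `l = m`. -/
theorem ghostMatrix_mul_realMatrix_same (a : Λ.Path) :
    ghostMatrix 𝕜 v n a * realMatrix 𝕜 v n a = realMatrix 𝕜 v n (Λ.idPath a.source) := by
  ext l m
  by_cases hl : a.source = l.1.range
  · obtain ⟨l', b, hb⟩ := exists_isSquare hn hl
    rw [ghostMatrix_mul_apply hb]
    by_cases hlm : l = m
    · subst hlm
      rw [realMatrix_apply hb, hl, realMatrix_idPath_apply hn, KP.isKPFamily.ghost_real_same]
      congr 1
      exact Subtype.ext hb.source_eq.symm
    · rw [realMatrix_idPath_apply_eq_zero hn fun h => absurd h hlm]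
      by_cases hm : ∃ d, IsSquare v a m l' d
      · obtain ⟨d, hd⟩ := hm
        rw [realMatrix_apply hd, KP.isKPFamily.ghost_real_ne (hb.deg_eq.symm.trans hd.deg_eq)]
        rintro rfl
        exact hlm (hb.unique' hd).2
      · rw [realMatrix_apply_eq_zero fun d hd => hm ⟨d, hd⟩, mul_zero]
  · rw [ghostMatrix_mul_apply_eq_zero hl, realMatrix_idPath_apply_eq_zero hn]
    rintro rfl h
    exact hl h.symm

theorem ghostMatrix_mul_realMatrix_ne (hd : a.deg = a'.deg) (h : a ≠ a') :
    ghostMatrix 𝕜 v n a * realMatrix 𝕜 v n a' = 0 := by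
  ext l m
  rw [Matrix.zero_apply]
  by_cases hl : a.source = l.1.range
  · obtain ⟨l', b, hb⟩ := exists_isSquare hn hl
    rw [ghostMatrix_mul_apply hb]
    by_cases hm : ∃ d, IsSquare v a' m l' d
    · obtain ⟨d, hd'⟩ := hm
      rw [realMatrix_apply hd', KP.isKPFamily.ghost_real_ne
        (hb.deg_eq.symm.trans (hd.trans hd'.deg_eq))]
      rintro rfl
      exact h (hb.unique' hd').1
    · rw [realMatrix_apply_eq_zero fun d hd => hm ⟨d, hd⟩, mul_zero]
  · exact ghostMatrix_mul_apply_eq_zero hl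

/-- For fixed `x` with range `u`, the squares `a l = x b` with `a` of degree `q` correspond to the
paths `b` of degree `q` into `s(x)`. The diagonal entry is thus the fourth relation of the sink
deletion at `s(x)`. -/
theorem realMatrix_idPath_eq_sum (u : Λ.Obj) (q : Fin k → ℕ) (F : Finset Λ.Path)
    (hF : ∀ a, a ∈ F ↔ a.range = u ∧ a.deg = q) :
    realMatrix 𝕜 v n (Λ.idPath u) = ∑ a ∈ F, realMatrix 𝕜 v n a * ghostMatrix 𝕜 v n a := by
  classical
  have key : ∀ (a : Λ.Path) (l x y : Λ.PathOfDeg n),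
      realMatrix 𝕜 v n a x l * ghostMatrix 𝕜 v n a l y ≠ 0 →
      x = y ∧ ∃ b, IsSquare v a l x b := by
    intro a l x y h
    have h₁ : ∃ b, IsSquare v a l x b := by
      by_contra h'
      exact left_ne_zero_of_mul h (realMatrix_apply_eq_zero fun b hb => h' ⟨b, hb⟩)
    have h₂ : ∃ b, IsSquare v a l y b := by
      by_contra h'
      exact right_ne_zero_of_mul h (ghostMatrix_apply_eq_zero fun b hb => h' ⟨b, hb⟩)
    exact ⟨(h₁.choose_spec.unique h₂.choose_spec).1, h₁⟩
  ext x y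
  simp only [Matrix.sum_apply, Matrix.mul_apply]
  rw [← Finset.sum_product']
  by_cases h : x = y ∧ y.1.range = u
  · obtain ⟨rfl, rfl⟩ := h
    let G := (RowFiniteNoSources.finite (Λ := Λ.sinkDeletion v) (sinkDeletionVert (hn x.1 x.2)) q).toFinset
    have hG : ∀ b, b ∈ G ↔ b.range = (sinkDeletionVert (hn x.1 x.2)) ∧ b.deg = q := by simp [G]
    rw [realMatrix_idPath_apply hn, KP.isKPFamily.vert_eq_sum _ q G hG]
    symm
    -- Pairs `(a, l)` that bound no square contribute zero, so only nonzero terms are matched; for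
    -- these, `key` supplies the square.
    refine Finset.sum_bij_ne_zero (fun al _ h => (key al.1 al.2 x x h).2.choose) ?_ ?_ ?_ ?_
    · intro al hal h
      have hb := (key al.1 al.2 x x h).2.choose_spec
      rw [hG, ← hb.deg_eq, ((hF _).1 (Finset.mem_product.1 hal).1).2]
      exact ⟨Subtype.ext hb.source_eq_range'.symm, rfl⟩
    · intro al _ h al' _ h' he
      have hb := (key al.1 al.2 x x h).2.choose_spec
      have hb' := (key al'.1 al'.2 x x h').2.choose_spec
      rw [he] at hb
      exact Prod.ext (hb.unique' hb').1 (hb.unique' hb').2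
    · intro b hb hne
      rw [hG] at hb
      obtain ⟨a, l, ha⟩ := exists_isSquare' (congrArg Subtype.val hb.1).symm
      have hne' : realMatrix 𝕜 v n a x l * ghostMatrix 𝕜 v n a l x ≠ 0 := by
        rwa [realMatrix_apply ha, ghostMatrix_apply ha]
      refine ⟨(a, l), ?_, hne', ?_⟩
      · rw [Finset.mem_product, hF]
        exact ⟨⟨ha.range_eq, ha.deg_eq.trans hb.2⟩, Finset.mem_univ _⟩
      · exact ((key a l x x hne').2.choose_spec.unique ha).2
    · intro al _ h
      have hb := (key al.1 al.2 x x h).2.choose_spec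
      rw [realMatrix_apply hb, ghostMatrix_apply hb]
  · rw [realMatrix_idPath_apply_eq_zero hn fun h₁ h₂ => h ⟨h₁, h₂⟩]
    refine (Finset.sum_eq_zero fun al hal => ?_).symm
    by_contra h'
    obtain ⟨rfl, b, hb⟩ := key _ _ _ _ h'
    exact h ⟨rfl, hb.range_eq.symm.trans ((hF _).1 (Finset.mem_product.1 hal).1).1⟩

/-- By the universal property this gives a homomorphism from the algebra of `Λ` to matrices over
that of the sink deletion, the device that detects injectivity. The relations between vertices and
paths are composition with paths of degree `0`. -/
theorem isKPFamily_matrix :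
    Λ.IsKPFamily (fun u => realMatrix 𝕜 v n (Λ.idPath u)) (realMatrix 𝕜 v n)
      (ghostMatrix 𝕜 v n) := by
  intro y z h
  cases h with
  | real_id u => rfl
  | ghost_id u => exact ghostMatrix_idPath hn u
  | kp1_same u => exact realMatrix_mul_realMatrix hn (isComp_idPath_left (Λ.idPath u))
  | @kp1_ne u u' h =>
    rw [← ghostMatrix_idPath hn]
    refine ghostMatrix_mul_realMatrix_ne hn ((Λ.deg_idPath u).trans (Λ.deg_idPath u').symm) ?_
    exact fun h' => h (congrArg Path.range h')
  | kp2_real g f => exact realMatrix_mul_realMatrix hn (isComp_path g f)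
  | kp2_ghost g f => exact ghostMatrix_mul_ghostMatrix hn (isComp_path g f)
  | kp2_vert_real a => exact realMatrix_mul_realMatrix hn (isComp_idPath_left a)
  | kp2_real_vert a => exact realMatrix_mul_realMatrix hn (isComp_idPath_right a)
  | kp2_vert_ghost a =>
    rw [← ghostMatrix_idPath hn]
    exact ghostMatrix_mul_ghostMatrix hn (isComp_idPath_right a)
  | kp2_ghost_vert a =>
    rw [← ghostMatrix_idPath hn]
    exact ghostMatrix_mul_ghostMatrix hn (isComp_idPath_left a)
  | kp3_same a => exact ghostMatrix_mul_realMatrix_same hn a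
  | kp3_ne ha hd h => exact ghostMatrix_mul_realMatrix_ne hn hd h
  | kp4 u q hq F hF => exact realMatrix_idPath_eq_sum hn u q F hF

end MatrixFamily

/-! ### The algebra of the sink deletion as a full corner -/

section FullCorner

variable {Λ : KGraph.{u} k} {v : Λ.Obj} {n : Fin k → ℕ}

open KP

/-! ### The image of the inclusion is a corner -/

section InclHom

variable (𝕜 : Type w) [Field 𝕜]

/-- The homomorphism from the algebra of the sink deletion given by the inclusion of paths. -/
def inclHom (v : Λ.Obj) : (Λ.sinkDeletion v).KP 𝕜 →ₙₐ[𝕜] Λ.KP 𝕜 :=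
  (exists_lift (isKPFamily.sinkDeletion (v := v))).choose

theorem inclHom_p (u : (Λ.sinkDeletion v).Obj) : inclHom 𝕜 v (p 𝕜 u) = p 𝕜 u.1 :=
  (exists_lift (isKPFamily.sinkDeletion (v := v))).choose_spec.1 u

theorem inclHom_s (a : (Λ.sinkDeletion v).Path) :
    inclHom 𝕜 v (s 𝕜 a) = s 𝕜 (Λ.sinkDeletionIncl v a) :=
  (exists_lift (isKPFamily.sinkDeletion (v := v))).choose_spec.2.1 a

theorem inclHom_t (a : (Λ.sinkDeletion v).Path) :
    inclHom 𝕜 v (t 𝕜 a) = t 𝕜 (Λ.sinkDeletionIncl v a) :=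
  (exists_lift (isKPFamily.sinkDeletion (v := v))).choose_spec.2.2 a

theorem inclHom_mem_component {γ : Fin k → ℤ} {b : (Λ.sinkDeletion v).KP 𝕜}
    (hb : b ∈ component 𝕜 (Λ.sinkDeletion v) γ) : inclHom 𝕜 v b ∈ component 𝕜 Λ γ := by
  induction hb using Submodule.span_induction with
  | mem y hy =>
    obtain ⟨a, b, h, rfl, rfl⟩ := hy
    rw [map_mul, inclHom_s, inclHom_t]
    exact mem_component (congrArg Subtype.val h) rfl
  | zero => rw [map_zero]; exact zero_mem _
  | add y z _ _ hy hz => rw [map_add]; exact add_mem hy hz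
  | smul r y _ hy => rw [map_smul]; exact Submodule.smul_mem _ _ hy

variable [Finite Λ.Obj]

theorem inclHom_one_mul_p {u : Λ.Obj} (h : ¬ Λ.Survives v u) :
    inclHom 𝕜 v 1 * p 𝕜 u = 0 := by
  let := Fintype.ofFinite (Λ.sinkDeletion v).Obj
  rw [one_eq_unit, unit, map_sum, Finset.sum_mul]
  refine Finset.sum_eq_zero fun z _ => ?_
  rw [inclHom_p, isKPFamily.vert_mul_ne]
  rintro rfl
  exact h z.2

theorem p_mul_inclHom_one {u : Λ.Obj} (h : ¬ Λ.Survives v u) :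
    p 𝕜 u * inclHom 𝕜 v 1 = 0 := by
  let := Fintype.ofFinite (Λ.sinkDeletion v).Obj
  rw [one_eq_unit, unit, map_sum, Finset.mul_sum]
  refine Finset.sum_eq_zero fun z _ => ?_
  rw [inclHom_p, isKPFamily.vert_mul_ne]
  rintro rfl
  exact h z.2

theorem inclHom_one_mul_p_of_survives {u : Λ.Obj} (h : Λ.Survives v u) :
    inclHom 𝕜 v 1 * p 𝕜 u = p 𝕜 u := by
  have := inclHom_p 𝕜 (sinkDeletionVert h)
  change _ = p 𝕜 u at this
  rw [← this, ← map_mul, one_mul]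

theorem p_mul_inclHom_one_of_survives {u : Λ.Obj} (h : Λ.Survives v u) :
    p 𝕜 u * inclHom 𝕜 v 1 = p 𝕜 u := by
  have := inclHom_p 𝕜 (sinkDeletionVert h)
  change _ = p 𝕜 u at this
  rw [← this, ← map_mul, mul_one]

/-- Cutting down `s_a s_{b^*}` gives zero unless both ranges survive, and then `a` and `b` lie in
the sink deletion. -/
theorem exists_inclHom_eq {γ : Fin k → ℤ} {a : Λ.KP 𝕜} (ha : a ∈ component 𝕜 Λ γ) :
    ∃ b ∈ component 𝕜 (Λ.sinkDeletion v) γ,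
      inclHom 𝕜 v b = inclHom 𝕜 v 1 * a * inclHom 𝕜 v 1 := by
  induction ha using Submodule.span_induction with
  | mem y hy =>
    obtain ⟨a, b, h, rfl, rfl⟩ := hy
    by_cases ha : Λ.Survives v a.range
    · by_cases hb : Λ.Survives v b.range
      · obtain ⟨a, rfl⟩ := exists_incl_eq ha
        obtain ⟨b, rfl⟩ := exists_incl_eq hb
        refine ⟨s 𝕜 a * t 𝕜 b, mem_component (Subtype.ext h) rfl, ?_⟩
        rw [← inclHom_s, ← inclHom_t, ← map_mul, ← map_mul, ← map_mul, one_mul, mul_one]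
      · refine ⟨0, zero_mem _, ?_⟩
        rw [map_zero, ← isKPFamily.ghost_vert b]
        simp only [mul_assoc]
        rw [p_mul_inclHom_one 𝕜 hb]
        simp only [mul_zero]
    · refine ⟨0, zero_mem _, ?_⟩
      rw [map_zero, ← isKPFamily.vert_real a]
      simp only [← mul_assoc]
      rw [inclHom_one_mul_p 𝕜 ha]
      simp only [zero_mul]
  | zero => exact ⟨0, zero_mem _, by simp⟩
  | add y z _ _ hy hz =>
    obtain ⟨b, hb, h⟩ := hy
    obtain ⟨b', hb', h'⟩ := hz
    exact ⟨b + b', add_mem hb hb', by rw [map_add, h, h', mul_add, add_mul]⟩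
  | smul r y _ hy =>
    obtain ⟨b, hb, h⟩ := hy
    exact ⟨r • b, Submodule.smul_mem _ _ hb, by rw [map_smul, h, mul_smul_comm, smul_mul_assoc]⟩

end InclHom

/-! ### Injectivity of the inclusion and fullness of the corner -/

section Injective

variable (𝕜 : Type w) [Field 𝕜]

open scoped Classical in
/-- The generator `s_a` of the algebra of the sink deletion, or `0` if `a` does not lie in it. -/
def restrictReal (v : Λ.Obj) (a : Λ.Path) : (Λ.sinkDeletion v).KP 𝕜 :=
  if h : ∃ b, Λ.sinkDeletionIncl v b = a then s 𝕜 h.choose else 0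

open scoped Classical in
/-- The generator `s_{a^*}` of the algebra of the sink deletion, or `0` if `a` does not lie in
it. -/
def restrictGhost (v : Λ.Obj) (a : Λ.Path) : (Λ.sinkDeletion v).KP 𝕜 :=
  if h : ∃ b, Λ.sinkDeletionIncl v b = a then t 𝕜 h.choose else 0

theorem restrictReal_incl (b : (Λ.sinkDeletion v).Path) :
    restrictReal 𝕜 v (Λ.sinkDeletionIncl v b) = s 𝕜 b := by
  have h : ∃ b', Λ.sinkDeletionIncl v b' = Λ.sinkDeletionIncl v b := ⟨b, rfl⟩
  rw [restrictReal, dif_pos h, Λ.sinkDeletionIncl_injective v h.choose_spec]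

theorem restrictGhost_incl (b : (Λ.sinkDeletion v).Path) :
    restrictGhost 𝕜 v (Λ.sinkDeletionIncl v b) = t 𝕜 b := by
  have h : ∃ b', Λ.sinkDeletionIncl v b' = Λ.sinkDeletionIncl v b := ⟨b, rfl⟩
  rw [restrictGhost, dif_pos h, Λ.sinkDeletionIncl_injective v h.choose_spec]

theorem restrictReal_eq_zero {a : Λ.Path} (h : ¬ Λ.Survives v a.range) :
    restrictReal 𝕜 v a = 0 :=
  dif_neg fun ⟨b, hb⟩ => h (hb ▸ b.range.2)

theorem restrictGhost_eq_zero {a : Λ.Path} (h : ¬ Λ.Survives v a.range) :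
    restrictGhost 𝕜 v a = 0 :=
  dif_neg fun ⟨b, hb⟩ => h (hb ▸ b.range.2)

variable [Λ.RowFiniteNoSources] [Finite Λ.Obj]

/-- Paths outside the sink deletion contribute zero; the others give the decomposition of its unit.
-/
theorem sum_restrictReal_mul_restrictGhost (v : Λ.Obj) (n : Fin k → ℕ) :
    ∑ a : Λ.PathOfDeg n, restrictReal 𝕜 v a.1 * restrictGhost 𝕜 v a.1 = 1 := by
  rw [← sum_real_mul_ghost 𝕜 n]
  symm
  refine Fintype.sum_of_injective
    (fun b : (Λ.sinkDeletion v).PathOfDeg n => ⟨Λ.sinkDeletionIncl v b.1, b.2⟩) ?_ _ _ ?_ ?_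
  · intro b b' h
    exact Subtype.ext (Λ.sinkDeletionIncl_injective v (congrArg Subtype.val h))
  · intro a ha
    rw [restrictReal_eq_zero, zero_mul]
    intro h
    obtain ⟨b, hb⟩ := exists_incl_eq h
    exact ha ⟨⟨b, by rw [← deg_incl, hb, a.2]⟩, Subtype.ext hb⟩
  · intro b
    rw [restrictReal_incl, restrictGhost_incl]

variable (hn : ∀ a : Λ.Path, a.deg = n → Λ.Survives v a.source)
include hn

/-- If `a y = z b`, then `s_a s_y = s_z s_b`, and `s_{x^*} s_z` vanishes unless `x = z`. All paths
into surviving vertices stay in the sink deletion, so this computation takes place in its algebra.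
-/
theorem realMatrix_incl_apply (a : (Λ.sinkDeletion v).Path) (x y : Λ.PathOfDeg n) :
    realMatrix 𝕜 v n (Λ.sinkDeletionIncl v a) x y =
      restrictGhost 𝕜 v x.1 * s 𝕜 a * restrictReal 𝕜 v y.1 := by
  by_cases hy : a.source.1 = y.1.range
  · obtain ⟨y', hy'⟩ := exists_incl_eq (v := v) (a := y.1) (hy ▸ a.source.2)
    obtain ⟨z, b, h⟩ := exists_isSquare hn (a := Λ.sinkDeletionIncl v a) hy
    obtain ⟨z', hz'⟩ := exists_incl_eq (v := v) (a := z.1) (h.range_eq ▸ a.range.2)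
    obtain ⟨c, h₁, h₂⟩ := id h
    obtain ⟨c, rfl⟩ := exists_incl_eq (v := v) (a := c) (h₁.range_eq ▸ a.range.2)
    rw [← hy'] at h₁
    rw [← hz'] at h₂
    rw [← hy', restrictReal_incl, mul_assoc, isKPFamily.real_mul_real h₁.of_incl,
      ← isKPFamily.real_mul_real h₂.of_incl, ← mul_assoc]
    by_cases hx : x = z
    · subst hx
      rw [realMatrix_apply h, ← hz', restrictGhost_incl, isKPFamily.ghost_real_same,
        h₂.of_incl.source_eq_range, isKPFamily.vert_real]
    · rw [realMatrix_apply_eq_zero fun _ hb => hx (hb.unique h).1]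
      by_cases hx' : Λ.Survives v x.1.range
      · obtain ⟨x', hx'⟩ := exists_incl_eq hx'
        rw [← hx', restrictGhost_incl, isKPFamily.ghost_real_ne, zero_mul]
        · rw [← deg_incl, ← deg_incl, hx', hz', x.2, z.2]
        · rintro rfl
          exact hx (Subtype.ext (hx'.symm.trans hz'))
      · rw [restrictGhost_eq_zero 𝕜 hx', zero_mul, zero_mul]
  · rw [realMatrix_apply_eq_zero fun _ hb => hy hb.source_eq_range]
    by_cases hy' : Λ.Survives v y.1.range
    · obtain ⟨y', hy'⟩ := exists_incl_eq hy'
      rw [← hy', restrictReal_incl, mul_assoc, s_mul_s_eq_zero, mul_zero]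
      intro h
      exact hy ((congrArg Subtype.val h).trans (congrArg Path.range hy'))
    · rw [restrictReal_eq_zero 𝕜 hy', mul_zero]

theorem ghostMatrix_incl_apply (a : (Λ.sinkDeletion v).Path) (y x : Λ.PathOfDeg n) :
    ghostMatrix 𝕜 v n (Λ.sinkDeletionIncl v a) y x =
      restrictGhost 𝕜 v y.1 * t 𝕜 a * restrictReal 𝕜 v x.1 := by
  by_cases hy : a.source.1 = y.1.range
  · obtain ⟨y', hy'⟩ := exists_incl_eq (v := v) (a := y.1) (hy ▸ a.source.2)
    obtain ⟨z, b, h⟩ := exists_isSquare hn (a := Λ.sinkDeletionIncl v a) hy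
    obtain ⟨z', hz'⟩ := exists_incl_eq (v := v) (a := z.1) (h.range_eq ▸ a.range.2)
    obtain ⟨c, h₁, h₂⟩ := id h
    obtain ⟨c, rfl⟩ := exists_incl_eq (v := v) (a := c) (h₁.range_eq ▸ a.range.2)
    rw [← hy'] at h₁
    rw [← hz'] at h₂
    rw [← hy', restrictGhost_incl, isKPFamily.ghost_mul_ghost h₁.of_incl,
      ← isKPFamily.ghost_mul_ghost h₂.of_incl, mul_assoc]
    by_cases hx : x = z
    · subst hx
      rw [ghostMatrix_apply h, ← hz', restrictReal_incl, isKPFamily.ghost_real_same,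
        h₂.of_incl.source_eq_range, isKPFamily.ghost_vert]
    · rw [ghostMatrix_apply_eq_zero fun _ hb => hx (hb.unique h).1]
      by_cases hx' : Λ.Survives v x.1.range
      · obtain ⟨x', hx'⟩ := exists_incl_eq hx'
        rw [← hx', restrictReal_incl, isKPFamily.ghost_real_ne, mul_zero]
        · rw [← deg_incl, ← deg_incl, hx', hz', x.2, z.2]
        · rintro rfl
          exact hx (Subtype.ext (hx'.symm.trans hz'))
      · rw [restrictReal_eq_zero 𝕜 hx', mul_zero, mul_zero]
  · rw [ghostMatrix_apply_eq_zero fun _ hb => hy hb.source_eq_range]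
    by_cases hy' : Λ.Survives v y.1.range
    · obtain ⟨y', hy'⟩ := exists_incl_eq hy'
      rw [← hy', restrictGhost_incl, t_mul_t_eq_zero, zero_mul]
      intro h
      exact hy ((congrArg Subtype.val h).symm.trans (congrArg Path.range hy'))
    · rw [restrictGhost_eq_zero 𝕜 hy', zero_mul, zero_mul]

theorem inclHom_injective : Function.Injective (inclHom 𝕜 v) := by
  obtain ⟨ψ, hp, hs, ht⟩ := exists_lift (𝕜 := 𝕜) (isKPFamily_matrix (𝕜 := 𝕜) hn)
  have key : ∀ b x y, ψ (inclHom 𝕜 v b) x y =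
      restrictGhost 𝕜 v x.1 * b * restrictReal 𝕜 v y.1 := by
    intro b
    induction b using KP.induction with
    | vert u =>
      intro x y
      rw [inclHom_p, hp, ← s_idPath u]
      exact realMatrix_incl_apply 𝕜 hn ((Λ.sinkDeletion v).idPath u) x y
    | real a =>
      intro x y
      rw [inclHom_s, hs, realMatrix_incl_apply 𝕜 hn]
    | ghost a =>
      intro x y
      rw [inclHom_t, ht, ghostMatrix_incl_apply 𝕜 hn]
    | zero => simp
    | add b c hb hc =>
      intro x y
      rw [map_add, map_add, Matrix.add_apply, hb, hc, mul_add, add_mul]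
    | mul b c hb hc =>
      intro x y
      rw [map_mul, map_mul, Matrix.mul_apply]
      simp only [hb, hc]
      -- The matrix product becomes the product `b c` after the resolution of `1` is inserted
      -- between the factors.
      conv_rhs => rw [← mul_one b, ← sum_restrictReal_mul_restrictGhost 𝕜 v n]
      simp only [Finset.mul_sum, Finset.sum_mul, mul_assoc]
    | smul r b hb =>
      intro x y
      rw [map_smul, map_smul, Matrix.smul_apply, hb, mul_smul_comm, smul_mul_assoc]
  refine (injective_iff_map_eq_zero _).2 fun b hb => ?_
  have h := sum_restrictReal_mul_restrictGhost 𝕜 v n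
  -- Resolving `1` on both sides writes `b` in terms of the entries of its matrix, which all vanish.
  calc b = 1 * b * 1 := by rw [one_mul, mul_one]
    _ = ∑ x : Λ.PathOfDeg n, ∑ y : Λ.PathOfDeg n, restrictReal 𝕜 v x.1 *
        (restrictGhost 𝕜 v x.1 * b * restrictReal 𝕜 v y.1) * restrictGhost 𝕜 v y.1 := by
      rw [← h]
      simp only [Finset.mul_sum, Finset.sum_mul, mul_assoc]
      exact Finset.sum_comm
    _ = 0 := by
      refine Finset.sum_eq_zero fun x _ => Finset.sum_eq_zero fun y _ => ?_
      rw [← key, hb, map_zero, Matrix.zero_apply, mul_zero, zero_mul]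

/-- If all paths of degree `n` have a surviving source, then the algebra of the sink deletion is
a full corner. -/
def fullCorner : GrMod.FullCorner (component 𝕜 Λ) (component 𝕜 (Λ.sinkDeletion v))
    (Fin (Fintype.card (Λ.PathOfDeg n))) where
  φ := (inclHom 𝕜 v : (Λ.sinkDeletion v).KP 𝕜 →ₙ+* Λ.KP 𝕜)
  map_mem _ _ := inclHom_mem_component 𝕜
  injective := inclHom_injective 𝕜 hn
  exists_mem _ _ := exists_inclHom_eq 𝕜
  -- The index type of a full corner lives in `Type`, whereas paths live in `Type u`, so the paths
  -- are enumerated by `Fin`.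
  d j := zdeg ((Fintype.equivFin (Λ.PathOfDeg n)).symm j).1
  x j := s 𝕜 ((Fintype.equivFin (Λ.PathOfDeg n)).symm j).1
  y j := t 𝕜 ((Fintype.equivFin (Λ.PathOfDeg n)).symm j).1
  x_mem _ := s_mem _
  y_mem _ := t_mem _
  x_mul_one j := by
    have h := p_mul_inclHom_one_of_survives 𝕜 (hn _ ((Fintype.equivFin (Λ.PathOfDeg n)).symm j).2)
    rw [← isKPFamily.real_vert, mul_assoc]
    exact congrArg _ h
  one_mul_y j := by
    have h := inclHom_one_mul_p_of_survives 𝕜 (hn _ ((Fintype.equivFin (Λ.PathOfDeg n)).symm j).2)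
    rw [← isKPFamily.vert_ghost, ← mul_assoc]
    exact congrArg (· * _) h
  sum_x_mul_y := by
    rw [← sum_real_mul_ghost 𝕜 n]
    exact (Fintype.equivFin (Λ.PathOfDeg n)).symm.sum_comp fun a => s 𝕜 a.1 * t 𝕜 a.1

end Injective

/-- If `v` is an `e_i`-sink, then the source of a path of degree `e_i` is not reached from `v`. -/
theorem IsSink.survives_source {i : Fin k} (hv : Λ.IsSink i v) (a : Λ.Path)
    (ha : a.deg = Pi.single i 1) : Λ.Survives v a.source := by
  refine ⟨fun f => ?_⟩
  obtain ⟨c, hc⟩ := exists_isComp (a := a) (b := Λ.path f) rfl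
  -- Refactor `a f` in the opposite order: its second factor has degree `e_i` and source `v`,
  -- contrary to the sink condition.
  obtain ⟨a', b, hb, -, hd⟩ := exists_isComp_of_deg_eq c (Λ.path f).deg (Pi.single i 1)
    (by rw [hc.deg_eq, ha, add_comm])
  exact Set.eq_empty_iff_forall_notMem.1 hv b ⟨hb.source_eq.symm.trans hc.source_eq, hd⟩

end FullCorner

end KGraph

end

theorem mainTheorem5 {k : ℕ} (Λ : KGraph.{u} k) [Λ.RowFiniteNoSources] [Finite Λ.Obj]
    (i : Fin k) (v : Λ.Obj) (hv : Λ.IsSink i v) (𝕜 : Type w) [Field 𝕜] :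
    GradedMoritaEquivalent (KGraph.KP.component 𝕜 Λ)
      (KGraph.KP.component 𝕜 (Λ.sinkDeletion v)) :=
  (KGraph.fullCorner 𝕜 hv.survives_source).gradedMoritaEquivalent
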